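/- Let $\Sigma$ be a compact connected Riemann surface, $\mathrm G\in\{\mathrm{SU}(2),\mathrm{SL}(2,\mathbb C)\}$ with Lie algebra $\mathfrak g$, and $\epsilon>0$. Let $\nabla^\tau=d+A(\tau)$, $\tau\in(-\epsilon,\epsilon)$, be a smooth family of flat $\mathrm G$-connections on the trivial $\mathbb C^2$-bundle over $\Sigma$ (that is, $A(\tau)\in\Omega^1(\Sigma,\mathfrak g)$ depends smoothly on $\tau$ and $dA(\tau)+A(\tau)\wedge A(\tau)=0$) with $\nabla^0=d$. For a smooth family of gauge transformations $g(\tau)\colon\Sigma\to\mathrm G$, $\tau\in(-\epsilon,\epsilon)$, put $$D(\tau):=\nabla^\tau.g(\tau)=d+g(\tau)^{-1}A(\tau)g(\tau)+g(\tau)^{-1}dg(\tau),\qquad D':=\tfrac{d}{d\tau}\Big|_{\tau=0}D(\tau),\qquad D'':=\tfrac{d^2}{d\tau^2}\Big|_{\tau=0}D(\tau).$$ Call $g$ a harmonic gauge for $\nabla^\tau$ if the $\mathfrak g$-valued $1$-form $D'$ is harmonic with respect to the flat connection $D(0)$, i.e. $d^{D(0)}D'=0=d^{D(0)}{*D'}$;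 if $g(0)$ is constant (for instance $g(0)=\mathrm{Id}$), then $D(0)=d$ and this says that $D'$ is harmonic in the usual sense, $dD'=0=d{*D'}$. 1. If $g$ is a harmonic gauge for $\nabla^\tau$, then the number $$K:=\frac{i}{2\pi}\int_\Sigma\operatorname{tr}(D'\wedge D'')$$ is independent of the choice of the harmonic gauge $g$. 2. Let $\tilde\nabla^\tau$, $\tau\in(-\epsilon,\epsilon)$, be another smooth family of flat $\mathrm G$-connections with $\tilde\nabla^0=d$ such that $\tilde\nabla^\tau=\nabla^\tau.h(\tau)$ for all $\tau\in(-\epsilon,\epsilon)$ and some smooth family of gauge transformations $h(\tau)\colon\Sigma\to\mathrm G$. Then the number $\tilde K$, computed for $\tilde\nabla^\tau$ with any harmonic gauge for $\tilde\nabla^\tau$, equals the number $K$ computed for $\nabla^\tau$ with any harmonic gauge for $\nabla^\tau$. -/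

import Mathlib

open scoped Manifold ContDiff Matrix.Norms.L2Operator

noncomputable section

namespace FlatFamily

/-- Complex `2 × 2` matrices. They carry the `ℓ²`-operator norm; only the topology and the
smooth structure it induces matter below. -/
abbrev Mat := Matrix (Fin 2) (Fin 2) ℂ

/-- The two structure groups `SU(2)` and `SL(2, ℂ)`. -/
inductive StructureGroup
  | SU2
  | SL2C

/-- The group as a set of matrices. -/
def StructureGroup.carrier : StructureGroup → Set Mat
  | .SU2 => {a | a ∈ Matrix.specialUnitaryGroup (Fin 2) ℂ}
  | .SL2C => {a | a.det = 1}

/-- The Lie algebra as a set of matrices: trace-free skew-Hermitian, respectively trace-free. -/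
def StructureGroup.lieAlg : StructureGroup → Set Mat
  | .SU2 => {a | a.conjTranspose = -a ∧ a.trace = 0}
  | .SL2C => {a | a.trace = 0}

/-! ### Differential forms on a Riemann surface

A Riemann surface is a space `S` with `[ChartedSpace ℂ S] [IsManifold 𝓘(ℂ, ℂ) ω S]`. As everywhere
in Mathlib, its tangent space at `p` is `ℂ`, identified through the preferred chart `chartAt ℂ p`. -/

section Forms

variable {S : Type*} [TopologicalSpace S] [ChartedSpace ℂ S]

/-- Fields of `ℝ`-linear maps `T_p S → V`, i.e. (not necessarily smooth) `V`-valued `1`-forms. -/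
abbrev OneForm (S V : Type*) [NormedAddCommGroup V] [NormedSpace ℝ V] := S → (ℂ →L[ℝ] V)

/-- `V`-valued `2`-forms, evaluated on pairs of tangent vectors; all those built below from `d` and
`∧` are `ℝ`-bilinear and alternating by construction. -/
abbrev TwoForm (S V : Type*) := S → ℂ → ℂ → V

/-- The differential at `z` of the inverse `e⁻¹` of a chart, as a map `ℂ → T_{e⁻¹(z)} S = ℂ`. -/
def chartDiff (e : OpenPartialHomeomorph S ℂ) (z : ℂ) : ℂ →L[ℝ] ℂ :=
  mfderiv 𝓘(ℝ, ℂ) 𝓘(ℝ, ℂ) e.symm z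

/-- The differential of a matrix-valued function. -/
def differential (g : S → Mat) : OneForm S Mat :=
  fun p => mfderiv 𝓘(ℝ, ℂ) 𝓘(ℝ, Mat) g p

/-- The expression of a `1`-form in the coordinate `z` of a chart `e`: its pull-back by `e⁻¹`. -/
def localRep {V : Type*} [NormedAddCommGroup V] [NormedSpace ℝ V]
    (e : OpenPartialHomeomorph S ℂ) (α : OneForm S V) (z : ℂ) : ℂ →L[ℝ] V :=
  (α (e.symm z)).comp (chartDiff e z)

/-- The exterior derivative of a `1`-form, `dα(u, v) = ∂_u α(v) - ∂_v α(u)`, computed at `p` in the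
chart that identifies `T_p S` with `ℂ`. -/
def extDer {V : Type*} [NormedAddCommGroup V] [NormedSpace ℝ V] (α : OneForm S V) : TwoForm S V :=
  fun p u v =>
    fderiv ℝ (localRep (chartAt ℂ p) α) (chartAt ℂ p p) u v
      - fderiv ℝ (localRep (chartAt ℂ p) α) (chartAt ℂ p p) v u

/-- The wedge product of matrix-valued `1`-forms. -/
def wedge (α β : OneForm S Mat) : TwoForm S Mat :=
  fun p u v => α p u * β p v - α p v * β p u

/-- The Hodge star on `1`-forms, `(⋆α)(v) = -α(J v)` with `J` the complex structure; in a
holomorphic coordinate `z = x + i y` this is `⋆dx = dy`, `⋆dy = -dx`. -/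
def hodgeStar {V : Type*} [NormedAddCommGroup V] [NormedSpace ℝ V] (α : OneForm S V) :
    OneForm S V :=
  fun p => -(α p).comp (ContinuousLinearMap.mul ℝ ℂ Complex.I)

/-- The family of `1`-forms `α(τ)`, `τ ∈ (-ε, ε)`, is smooth, jointly in `τ` and the point. -/
def SmoothFormFamily {V : Type*} [NormedAddCommGroup V] [NormedSpace ℝ V]
    (ε : ℝ) (α : ℝ → OneForm S V) : Prop :=
  ∀ p : S, ContDiffOn ℝ ∞ (fun x : ℝ × ℂ => localRep (chartAt ℂ p) (α x.1) x.2)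
    (Set.Ioo (-ε) ε ×ˢ (chartAt ℂ p).target)

end Forms

/-! ### Integration of `2`-forms over a compact Riemann surface -/

section Integration

/-- A Riemann surface is a smooth real surface. -/
theorem isManifold_real (S : Type*) [TopologicalSpace S] [ChartedSpace ℂ S]
    [IsManifold 𝓘(ℂ, ℂ) ω S] : IsManifold 𝓘(ℝ, ℂ) ∞ S := by
  refine isManifold_of_contDiffOn _ _ _ fun e e' he he' => ?_
  have h := (contDiffGroupoid ω 𝓘(ℂ, ℂ)).compatible he he'
  have h2 := (contDiffGroupoid ω 𝓘(ℂ, ℂ)).mem_of_eqOnSource h (Setoid.refl _)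
  rw [contDiffGroupoid, mem_groupoid_of_pregroupoid] at h2
  have h3 : ContDiffOn ℂ ω (e.symm ≫ₕ e') (e.symm ≫ₕ e').source := by
    simpa [contDiffPregroupoid] using h2.1
  simpa using (h3.restrict_scalars ℝ).of_le le_top

variable (S : Type*) [TopologicalSpace S] [T2Space S] [CompactSpace S] [ChartedSpace ℂ S]
  [IsManifold 𝓘(ℂ, ℂ) ω S]

theorem exists_chartPartition :
    ∃ ρ : SmoothPartitionOfUnity S 𝓘(ℝ, ℂ) S Set.univ,
      ρ.IsSubordinate fun p => (chartAt ℂ p).source :=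
  haveI := isManifold_real S
  SmoothPartitionOfUnity.exists_isSubordinate_chartAt_source 𝓘(ℝ, ℂ) S

/-- A smooth partition of unity subordinate to the cover by chart domains. -/
def chartPartition : SmoothPartitionOfUnity S 𝓘(ℝ, ℂ) S Set.univ :=
  (exists_chartPartition S).choose

variable {S}

/-- The coefficient of `dx ∧ dy` of a `2`-form in the coordinate `z = x + i y` of a chart `e`. -/
def localCoeff (e : OpenPartialHomeomorph S ℂ) (Ω : TwoForm S ℂ) (z : ℂ) : ℂ :=
  Ω (e.symm z) (chartDiff e z 1) (chartDiff e z Complex.I)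

/-- The integral of a complex-valued `2`-form over a compact Riemann surface with its complex
orientation: cut the form with a partition of unity and integrate the pieces in charts. -/
def surfaceIntegral (Ω : TwoForm S ℂ) : ℂ :=
  ∑ᶠ p : S, ∫ z in (chartAt ℂ p).target,
    (chartPartition S p ((chartAt ℂ p).symm z) : ℂ) * localCoeff (chartAt ℂ p) Ω z

end Integration

/-! ### Families of flat connections and gauge transformations

A `G`-connection on the trivial `ℂ²`-bundle is `∇ = d + A` with `A` a `𝔤`-valued `1`-form; it is
represented by `A`, and the trivial connection `d` by `0`. -/

section Connections

variable {S : Type*} [TopologicalSpace S] [ChartedSpace ℂ S]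

/-- The curvature `F = dA + A ∧ A` of `d + A`. -/
def curvatureForm (A : OneForm S Mat) : TwoForm S Mat := extDer A + wedge A A

/-- The covariant exterior derivative `d^∇ α = dα + [A ∧ α]` of a matrix-valued `1`-form for
`∇ = d + A`; here `[A ∧ α] = A ∧ α + α ∧ A`. -/
def covExtDer (A α : OneForm S Mat) : TwoForm S Mat := extDer α + wedge A α + wedge α A

/-- `α` is harmonic with respect to the connection `∇ = d + A`: `d^∇ α = 0 = d^∇ ⋆α`.
For `A = 0` this is ordinary harmonicity. -/
def IsHarmonicWith (A α : OneForm S Mat) : Prop :=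
  covExtDer A α = 0 ∧ covExtDer A (hodgeStar α) = 0

/-- The gauge action `(d + A).g = g⁻¹ ∘ (d + A) ∘ g = d + g⁻¹ A g + g⁻¹ dg`. -/
def gaugeAct (A : OneForm S Mat) (g : S → Mat) : OneForm S Mat := fun p =>
  (ContinuousLinearMap.mulLeftRight ℝ Mat (g p)⁻¹ (g p)).comp (A p)
    + (ContinuousLinearMap.mul ℝ Mat (g p)⁻¹).comp (differential g p)

/-- A smooth family, `τ ∈ (-ε, ε)`, of flat `G`-connections `∇^τ = d + A(τ)` with `∇^0 = d`. -/
structure IsFlatFamily (G : StructureGroup) (ε : ℝ) (A : ℝ → OneForm S Mat) : Prop where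
  smooth : SmoothFormFamily ε A
  mem_lieAlg : ∀ τ ∈ Set.Ioo (-ε) ε, ∀ p v, A τ p v ∈ G.lieAlg
  flat : ∀ τ ∈ Set.Ioo (-ε) ε, curvatureForm (A τ) = 0
  at_zero : A 0 = 0

/-- A smooth family, `τ ∈ (-ε, ε)`, of gauge transformations `g(τ) : S → G`. -/
structure IsGaugeFamily (G : StructureGroup) (ε : ℝ) (g : ℝ → S → Mat) : Prop where
  smooth : ContMDiffOn (𝓘(ℝ, ℝ).prod 𝓘(ℝ, ℂ)) 𝓘(ℝ, Mat) ∞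
    (fun x : ℝ × S => g x.1 x.2) (Set.Ioo (-ε) ε ×ˢ Set.univ)
  mem_group : ∀ τ ∈ Set.Ioo (-ε) ε, ∀ p, g τ p ∈ G.carrier

/-- The gauged family `D(τ) = ∇^τ.g(τ)`. -/
def gauged (A : ℝ → OneForm S Mat) (g : ℝ → S → Mat) : ℝ → OneForm S Mat :=
  fun τ => gaugeAct (A τ) (g τ)

/-- The first derivative at `τ = 0` of a family of connections. -/
def firstDeriv (D : ℝ → OneForm S Mat) : OneForm S Mat := fun p => deriv (fun τ => D τ p) 0

/-- The second derivative at `τ = 0` of a family of connections. -/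
def secondDeriv (D : ℝ → OneForm S Mat) : OneForm S Mat :=
  fun p => iteratedDeriv 2 (fun τ => D τ p) 0

/-- A harmonic gauge for `∇^τ = d + A(τ)`: a smooth family of gauge transformations such that the
derivative `D'` at `τ = 0` of `D(τ) = ∇^τ.g(τ)` is harmonic. Harmonicity refers to the flat
connection `D(0)`, which is `d` exactly when `g(0)` is locally constant, e.g. `g(0) = Id`. -/
structure IsHarmonicGauge (G : StructureGroup) (ε : ℝ) (A : ℝ → OneForm S Mat)
    (g : ℝ → S → Mat) : Prop where
  gauge : IsGaugeFamily G ε g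
  harmonic : IsHarmonicWith (gauged A g 0) (firstDeriv (gauged A g))

/-- `K = (i / 2π) ∫_S tr(D' ∧ D'')` for `D(τ) = ∇^τ.g(τ)`. -/
def curvatureK [T2Space S] [CompactSpace S] [IsManifold 𝓘(ℂ, ℂ) ω S]
    (A : ℝ → OneForm S Mat) (g : ℝ → S → Mat) : ℂ :=
  Complex.I / (2 * Real.pi) * surfaceIntegral (fun (p : S) u v =>
    (wedge (firstDeriv (gauged A g)) (secondDeriv (gauged A g)) p u v).trace)

end Connections

end FlatFamily

end

noncomputable section

namespace FlatFamily

open Set Filter Topology MeasureTheory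

/-! ### Charts and the exterior derivative -/

section Charts

variable {S : Type*} [TopologicalSpace S] [ChartedSpace ℂ S]

/-! Write α = A'(0) and β = A''(0). Since A(0) = 0, differentiating g D = A g + dg at τ = 0 with g'
= ξ g(0) and g'' = η g(0) gives D' = g(0)⁻¹ E g(0) with E = α + dξ, and D'' = g(0)⁻¹ (β + 2αξ − 2ξE
+ dη) g(0) (`exists_gauged_derivatives`). Conjugation by g(0) does not affect the trace form. As
D(0) is the image of d under g(0), harmonicity of D' for D(0) is ordinary harmonicity of E
(`covExtDer_adForm`).

For two harmonic gauges the forms E differ by dc with c = ξ₂ − ξ₁, so c is harmonic. Integrating d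
tr(cᴴ ⋆dc) over the compact surface forces dc = 0 (`differential_eq_zero_of_harmonic`), and E is
common to both gauges. By cyclicity of the trace the two integrands then differ by 4 tr(E∧E c) − 2
tr(E∧dξ₁ c) + tr(E∧d(η₂ − η₁)). Differentiating the flatness equation once and twice gives dα = 0
and dβ = −2 α∧α (`IsFlatFamily.extDer_derivatives`). Hence dE = 0, and α∧α c is exact. Since E∧E =
α∧α + dξ₁∧E + α∧dξ₁, every term above is exact (`exists_trace_wedge_eq_add_extDer`), and Stokes
(`surfaceIntegral_extDer`) gives the first claim.

The second claim reduces to the first: gauge transformations act on the right, so a harmonic gauge k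
for B = A.h yields the harmonic gauge hk for A, with the same D(τ). -/

theorem contDiffAt_transition {𝕜 : Type*} [NontriviallyNormedField 𝕜] [NormedSpace 𝕜 ℂ]
    {n : WithTop ℕ∞} [IsManifold 𝓘(𝕜, ℂ) n S]
    {e e' : OpenPartialHomeomorph S ℂ} (he : e ∈ atlas ℂ S) (he' : e' ∈ atlas ℂ S) {z : ℂ}
    (hz : z ∈ e.target) (hz' : e.symm z ∈ e'.source) : ContDiffAt 𝕜 n (e' ∘ e.symm) z := by
  have h1 := contMDiffAt_symm_of_mem_maximalAtlas (I := 𝓘(𝕜, ℂ)) (n := n)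
    (IsManifold.subset_maximalAtlas he) hz
  have h2 := contMDiffAt_of_mem_maximalAtlas (I := 𝓘(𝕜, ℂ)) (n := n)
    (IsManifold.subset_maximalAtlas he') hz'
  exact contMDiffAt_iff_contDiffAt.1 (h2.comp z h1)

variable {V W X : Type*} [NormedAddCommGroup V] [NormedSpace ℝ V]
  [NormedAddCommGroup W] [NormedSpace ℝ W] [NormedAddCommGroup X] [NormedSpace ℝ X]

/-- A smooth `1`-form. -/
def SmoothForm (α : OneForm S V) : Prop :=
  ∀ p : S, ContDiffOn ℝ ∞ (localRep (chartAt ℂ p) α) (chartAt ℂ p).target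

/-- A smooth function, in terms of its expressions in the preferred charts. -/
def SmoothFun (f : S → V) : Prop :=
  ∀ p : S, ContDiffOn ℝ ∞ (f ∘ (chartAt ℂ p).symm) (chartAt ℂ p).target

theorem SmoothForm.differentiableAt {α : OneForm S V} (hα : SmoothForm α) (p : S) {z : ℂ}
    (hz : z ∈ (chartAt ℂ p).target) : DifferentiableAt ℝ (localRep (chartAt ℂ p) α) z :=
  ((hα p).contDiffAt ((chartAt ℂ p).open_target.mem_nhds hz)).differentiableAt (by simp)

theorem SmoothFun.differentiableAt {f : S → V} (hf : SmoothFun f) (p : S) {z : ℂ}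
    (hz : z ∈ (chartAt ℂ p).target) : DifferentiableAt ℝ (f ∘ (chartAt ℂ p).symm) z :=
  ((hf p).contDiffAt ((chartAt ℂ p).open_target.mem_nhds hz)).differentiableAt (by simp)

/-- Pull-back commutes with d: the terms containing the second derivative of ψ cancel because that
derivative is symmetric. -/
theorem fderiv_pullback_antisymm {α : ℂ → ℂ →L[ℝ] V} {ψ : ℂ → ℂ} {z : ℂ}
    (hα : DifferentiableAt ℝ α (ψ z)) (hψ : ContDiffAt ℝ ∞ ψ z) (u v : ℂ) :
    fderiv ℝ (fun w => (α (ψ w)).comp (fderiv ℝ ψ w)) z u v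
        - fderiv ℝ (fun w => (α (ψ w)).comp (fderiv ℝ ψ w)) z v u
      = fderiv ℝ α (ψ z) (fderiv ℝ ψ z u) (fderiv ℝ ψ z v)
        - fderiv ℝ α (ψ z) (fderiv ℝ ψ z v) (fderiv ℝ ψ z u) := by
  have h1 : HasFDerivAt (fun w => α (ψ w)) ((fderiv ℝ α (ψ z)).comp (fderiv ℝ ψ z)) z :=
    hα.hasFDerivAt.comp z (hψ.differentiableAt (by simp)).hasFDerivAt
  have h2 : HasFDerivAt (fderiv ℝ ψ) (fderiv ℝ (fderiv ℝ ψ) z) z :=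
    ((hψ.fderiv_right (m := ∞) (by simp)).differentiableAt (by simp)).hasFDerivAt
  have hs : IsSymmSndFDerivAt ℝ ψ z := hψ.isSymmSndFDerivAt (by simpa using ENat.LEInfty.out)
  rw [(h1.clm_comp h2).fderiv]
  simp [hs.eq u v]

/-! ### Linear and bilinear operations on forms -/

theorem localRep_add (e : OpenPartialHomeomorph S ℂ) (α β : OneForm S V) :
    localRep e (α + β) = localRep e α + localRep e β := by
  funext z; ext1 v; simp [localRep]

theorem SmoothForm.add {α β : OneForm S V} (hα : SmoothForm α) (hβ : SmoothForm β) :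
    SmoothForm (α + β) := fun p => by
  rw [localRep_add]; exact (hα p).add (hβ p)

theorem extDer_add {α β : OneForm S V} (hα : SmoothForm α) (hβ : SmoothForm β) :
    extDer (α + β) = extDer α + extDer β := by
  funext p u v
  have hz := mem_chart_target ℂ p
  simp only [extDer, localRep_add, Pi.add_apply,
    fderiv_add (hα.differentiableAt p hz) (hβ.differentiableAt p hz), _root_.add_apply]
  abel

/-- The `1`-form obtained by applying a linear map to the values. -/
def mapForm (L : V →L[ℝ] W) (α : OneForm S V) : OneForm S W := fun p => L.comp (α p)

theorem localRep_mapForm (e : OpenPartialHomeomorph S ℂ) (L : V →L[ℝ] W) (α : OneForm S V) :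
    localRep e (mapForm L α) = fun z => L.comp (localRep e α z) := rfl

theorem SmoothForm.map {α : OneForm S V} (hα : SmoothForm α) (L : V →L[ℝ] W) :
    SmoothForm (mapForm L α) := fun p => by
  rw [localRep_mapForm]; exact contDiffOn_const.clm_comp (hα p)

theorem extDer_mapForm {α : OneForm S V} (hα : SmoothForm α) (L : V →L[ℝ] W) (p : S) (u v : ℂ) :
    extDer (mapForm L α) p u v = L (extDer α p u v) := by
  have h := (hasFDerivAt_const L (chartAt ℂ p p)).clm_comp
    (hα.differentiableAt p (mem_chart_target ℂ p)).hasFDerivAt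
  simp only [extDer, localRep_mapForm]
  rw [h.fderiv]
  simp

/-- The product of a function and a `1`-form under a bilinear map. -/
def bilinForm (B : V →L[ℝ] W →L[ℝ] X) (f : S → V) (α : OneForm S W) : OneForm S X :=
  fun p => (B (f p)).comp (α p)

theorem localRep_bilinForm (e : OpenPartialHomeomorph S ℂ) (B : V →L[ℝ] W →L[ℝ] X) (f : S → V)
    (α : OneForm S W) :
    localRep e (bilinForm B f α) = fun z => (B ((f ∘ e.symm) z)).comp (localRep e α z) := rfl

theorem SmoothFun.smoothForm_bilinForm {f : S → V} {α : OneForm S W} (hf : SmoothFun f)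
    (hα : SmoothForm α) (B : V →L[ℝ] W →L[ℝ] X) : SmoothForm (bilinForm B f α) := fun p => by
  rw [localRep_bilinForm]
  exact (B.contDiff.comp_contDiffOn (hf p)).clm_comp (hα p)

/-! ### Dependence on the chart -/

variable [IsManifold 𝓘(ℝ, ℂ) ∞ S]

theorem chartDiff_eq_comp {e e' : OpenPartialHomeomorph S ℂ} (he : e ∈ atlas ℂ S)
    (he' : e' ∈ atlas ℂ S) {z : ℂ} (hz : z ∈ e.target) (hz' : e.symm z ∈ e'.source) :
    chartDiff e z = (chartDiff e' (e' (e.symm z))).comp (fderiv ℝ (e' ∘ e.symm) z) := by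
  have h1 : MDifferentiableAt 𝓘(ℝ, ℂ) 𝓘(ℝ, ℂ) (e' ∘ e.symm) z :=
    ((contDiffAt_transition (𝕜 := ℝ) (n := ∞) he he' hz hz').differentiableAt
      (by simp)).mdifferentiableAt
  have h2 : MDifferentiableAt 𝓘(ℝ, ℂ) 𝓘(ℝ, ℂ) e'.symm ((e' ∘ e.symm) z) :=
    mdifferentiableAt_atlas_symm he' (e'.map_source hz')
  have h3 := mfderiv_comp z h2 h1
  rw [mfderiv_eq_fderiv] at h3
  have h4 : e.symm =ᶠ[𝓝 z] e'.symm ∘ e' ∘ e.symm := by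
    have : ∀ᶠ w in 𝓝 z, e.symm w ∈ e'.source :=
      (e.continuousAt_symm hz).eventually (e'.open_source.mem_nhds hz')
    filter_upwards [this] with w hw
    simp [e'.left_inv hw]
  exact (h4.mfderiv_eq).trans h3

/-- The tangent space at p is ℂ by way of the preferred chart, so that chart reads as the identity,
but only at p itself. -/
theorem chartDiff_chartAt (p : S) :
    chartDiff (chartAt ℂ p) (chartAt ℂ p p) = ContinuousLinearMap.id ℝ ℂ := by
  have hz : chartAt ℂ p p ∈ (chartAt ℂ p).target := mem_chart_target ℂ p
  have h := (mdifferentiableAt_atlas_symm (I := 𝓘(ℝ, ℂ)) (chart_mem_atlas ℂ p) hz)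
  have hp : (chartAt ℂ p).symm (chartAt ℂ p p) = p := (chartAt ℂ p).left_inv (mem_chart_source ℂ p)
  unfold chartDiff
  rw [h.mfderiv]
  simp only [writtenInExtChartAt, extChartAt, mfld_simps, hp, fderivWithin_univ]
  have : (chartAt ℂ p) ∘ (chartAt ℂ p).symm =ᶠ[𝓝 (chartAt ℂ p p)] id := by
    filter_upwards [(chartAt ℂ p).open_target.mem_nhds hz] with w hw
    simp [(chartAt ℂ p).right_inv hw]
  exact this.fderiv_eq.trans fderiv_id

theorem localRep_chartAt (α : OneForm S V) (p : S) :
    localRep (chartAt ℂ p) α (chartAt ℂ p p) = α p := by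
  rw [localRep, chartDiff_chartAt, (chartAt ℂ p).left_inv (mem_chart_source ℂ p)]
  rfl

theorem localRep_eq_comp {e e' : OpenPartialHomeomorph S ℂ} (he : e ∈ atlas ℂ S)
    (he' : e' ∈ atlas ℂ S) (α : OneForm S V) {z : ℂ} (hz : z ∈ e.target)
    (hz' : e.symm z ∈ e'.source) :
    localRep e α z = (localRep e' α (e' (e.symm z))).comp (fderiv ℝ (e' ∘ e.symm) z) := by
  rw [localRep, localRep, chartDiff_eq_comp he he' hz hz', e'.left_inv hz']
  rfl

/-- `extDer` uses a different chart at every point. Naturality under transition maps allows one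
fixed chart to be used on its whole domain, as smoothness and integration require. -/
theorem extDer_apply_chartDiff {α : OneForm S V} (hα : SmoothForm α) {e : OpenPartialHomeomorph S ℂ}
    (he : e ∈ atlas ℂ S) {z : ℂ} (hz : z ∈ e.target) (u v : ℂ) :
    extDer α (e.symm z) (chartDiff e z u) (chartDiff e z v)
      = fderiv ℝ (localRep e α) z u v - fderiv ℝ (localRep e α) z v u := by
  set p := e.symm z with hp
  set c := chartAt ℂ p
  have hc : c ∈ atlas ℂ S := chart_mem_atlas ℂ p
  have hpc : e.symm z ∈ c.source := mem_chart_source ℂ p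
  have hD : chartDiff e z = fderiv ℝ (c ∘ e.symm) z := by
    rw [chartDiff_eq_comp he hc hz hpc, ← hp, chartDiff_chartAt]; rfl
  have hev : localRep e α =ᶠ[𝓝 z]
      fun w => (localRep c α ((c ∘ e.symm) w)).comp (fderiv ℝ (c ∘ e.symm) w) := by
    have h1 : ∀ᶠ w in 𝓝 z, e.symm w ∈ c.source :=
      (e.continuousAt_symm hz).eventually (c.open_source.mem_nhds hpc)
    filter_upwards [h1, e.open_target.mem_nhds hz] with w hw hw'
    exact localRep_eq_comp he hc α hw' hw
  rw [hev.fderiv_eq, fderiv_pullback_antisymm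
    (hα.differentiableAt p (c.map_source hpc)) (contDiffAt_transition he hc hz hpc), hD]
  rfl

theorem SmoothFun.contMDiffAt {f : S → V} (hf : SmoothFun f) (p : S) :
    ContMDiffAt 𝓘(ℝ, ℂ) 𝓘(ℝ, V) ∞ f p := by
  have h1 := contMDiffAt_of_mem_maximalAtlas (I := 𝓘(ℝ, ℂ)) (n := ∞)
    (IsManifold.chart_mem_maximalAtlas (I := 𝓘(ℝ, ℂ)) (n := ∞) p) (mem_chart_source ℂ p)
  have h2 : ContMDiffAt 𝓘(ℝ, ℂ) 𝓘(ℝ, V) ∞ (f ∘ (chartAt ℂ p).symm) (chartAt ℂ p p) :=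
    contMDiffAt_iff_contDiffAt.2 ((hf p).contDiffAt
      ((chartAt ℂ p).open_target.mem_nhds (mem_chart_target ℂ p)))
  refine (h2.comp p h1).congr_of_eventuallyEq ?_
  filter_upwards [(chartAt ℂ p).open_source.mem_nhds (mem_chart_source ℂ p)] with q hq
  simp [(chartAt ℂ p).left_inv hq]

theorem smoothFun_of_contMDiff {f : S → V} (hf : ContMDiff 𝓘(ℝ, ℂ) 𝓘(ℝ, V) ∞ f) :
    SmoothFun f := by
  intro p
  have h1 := contMDiffOn_symm_of_mem_maximalAtlas (I := 𝓘(ℝ, ℂ)) (n := ∞)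
    (IsManifold.chart_mem_maximalAtlas (I := 𝓘(ℝ, ℂ)) (n := ∞) p)
  exact contMDiffOn_iff_contDiffOn.1 (hf.comp_contMDiffOn h1)

theorem localRep_differential {f : S → Mat} (hf : SmoothFun f) {e : OpenPartialHomeomorph S ℂ}
    (he : e ∈ atlas ℂ S) {z : ℂ} (hz : z ∈ e.target) :
    localRep e (differential f) z = fderiv ℝ (f ∘ e.symm) z := by
  have h := mfderiv_comp z ((hf.contMDiffAt (e.symm z)).mdifferentiableAt (by simp))
    (mdifferentiableAt_atlas_symm (I := 𝓘(ℝ, ℂ)) he hz)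
  rw [mfderiv_eq_fderiv] at h
  exact h.symm

theorem differential_eq {f : S → Mat} (hf : SmoothFun f) (p : S) :
    differential f p = fderiv ℝ (f ∘ (chartAt ℂ p).symm) (chartAt ℂ p p) := by
  rw [← localRep_differential hf (chart_mem_atlas ℂ p) (mem_chart_target ℂ p), localRep_chartAt]

theorem SmoothFun.smoothForm_differential {f : S → Mat} (hf : SmoothFun f) :
    SmoothForm (differential f) := fun p =>
  ((hf p).fderiv_of_isOpen (m := ∞) (chartAt ℂ p).open_target (by simp)).congr
    fun _ hz => localRep_differential hf (chart_mem_atlas ℂ p) hz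

theorem extDer_differential {f : S → Mat} (hf : SmoothFun f) : extDer (differential f) = 0 := by
  funext p u v
  have hz := mem_chart_target ℂ p
  have hev : localRep (chartAt ℂ p) (differential f) =ᶠ[𝓝 (chartAt ℂ p p)]
      fderiv ℝ (f ∘ (chartAt ℂ p).symm) := by
    filter_upwards [(chartAt ℂ p).open_target.mem_nhds hz] with z hz
    exact localRep_differential hf (chart_mem_atlas ℂ p) hz
  have hs : IsSymmSndFDerivAt ℝ (f ∘ (chartAt ℂ p).symm) (chartAt ℂ p p) :=
    ((hf p).contDiffAt ((chartAt ℂ p).open_target.mem_nhds hz)).isSymmSndFDerivAt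
      (by simpa using ENat.LEInfty.out)
  simp only [extDer, hev.fderiv_eq, hs.eq u v, sub_self, Pi.zero_apply]

/-! ### Leibniz rule -/

/-- A general bilinear pairing covers all products needed later: scalar cutoffs, left and right
matrix multiplication, and (a, b) ↦ aᴴ b. -/
theorem extDer_bilinForm {f : S → V} {α : OneForm S W} (hf : SmoothFun f)
    (hα : SmoothForm α) (B : V →L[ℝ] W →L[ℝ] X) (p : S) (u v : ℂ) :
    extDer (bilinForm B f α) p u v =
      B (fderiv ℝ (f ∘ (chartAt ℂ p).symm) (chartAt ℂ p p) u) (α p v)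
        - B (fderiv ℝ (f ∘ (chartAt ℂ p).symm) (chartAt ℂ p p) v) (α p u)
        + B (f p) (extDer α p u v) := by
  have hz := mem_chart_target ℂ p
  have h := (B.hasFDerivAt.comp (chartAt ℂ p p) (hf.differentiableAt p hz).hasFDerivAt).clm_comp
    (hα.differentiableAt p hz).hasFDerivAt
  simp only [extDer, localRep_bilinForm]
  erw [h.fderiv]
  simp [localRep_chartAt]
  abel

end Charts

/-! ### Integration in the plane -/

section Plane

theorem det_eq_re_mul_im_sub (L : ℂ →L[ℝ] ℂ) :
    L.det = (L 1).re * (L Complex.I).im - (L 1).im * (L Complex.I).re := by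
  rw [ContinuousLinearMap.det, ← LinearMap.det_toMatrix Complex.basisOneI, Matrix.det_fin_two]
  simp [LinearMap.toMatrix_apply]
  ring

/-- By the Cauchy–Riemann equations the real Jacobian of ψ is |ψ'|²; holomorphic transitions
therefore preserve orientation. -/
theorem det_fderiv_nonneg {ψ : ℂ → ℂ} {z : ℂ} (h : DifferentiableAt ℂ ψ z) :
    0 ≤ (fderiv ℝ ψ z).det := by
  rw [h.fderiv_restrictScalars ℝ, det_eq_re_mul_im_sub]
  have h1 : fderiv ℂ ψ z Complex.I = Complex.I * fderiv ℂ ψ z 1 := by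
    rw [← smul_eq_mul, ← map_smul, smul_eq_mul, mul_one]
  simp only [ContinuousLinearMap.coe_restrictScalars', h1, Complex.mul_re, Complex.mul_im,
    Complex.I_re, Complex.I_im]
  nlinarith [sq_nonneg (fderiv ℂ ψ z 1).re, sq_nonneg (fderiv ℂ ψ z 1).im]

/-- An alternating form on a real plane is a multiple of the area form; this puts exterior
derivatives into the shape used for change of variables. -/
theorem antisymm_eq_smul {V : Type*} [NormedAddCommGroup V] [NormedSpace ℝ V]
    (T : ℂ →L[ℝ] ℂ →L[ℝ] V) (u v : ℂ) :
    T u v - T v u = (u.re * v.im - u.im * v.re) • (T 1 Complex.I - T Complex.I 1) := by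
  have h : ∀ w : ℂ, w = w.re • (1 : ℂ) + w.im • Complex.I := fun w => by
    simp [Complex.re_add_im]
  conv_lhs => rw [h u, h v]
  simp only [map_add, map_smul, _root_.add_apply, _root_.smul_apply]
  module

/-- Integration by parts against the constant function 1. -/
theorem integral_fderiv_eq_zero {f : ℂ → ℂ} (hf : ContDiff ℝ 1 f) (hc : HasCompactSupport f)
    (v : ℂ) : ∫ z, fderiv ℝ f z v = 0 := by
  have h := integral_mul_fderiv_eq_neg_fderiv_mul_of_integrable (μ := (volume : Measure ℂ))
    (f := fun _ : ℂ => (1 : ℂ)) (g := f) (v := v) (by simp) ?_ ?_ (by simp)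
    (fun x _ => hf.differentiable (by simp) x)
  · simpa using h
  · simpa using ((hf.continuous_fderiv (by simp)).clm_apply
      continuous_const).integrable_of_hasCompactSupport
      (hc.fderiv_apply (𝕜 := ℝ) (v := v))
  · simpa using hf.continuous.integrable_of_hasCompactSupport hc

theorem contDiff_indicator {V : Type*} [NormedAddCommGroup V] [NormedSpace ℝ V]
    {f : ℂ → V} {U K : Set ℂ} {n : WithTop ℕ∞} (hU : IsOpen U) (hK : IsClosed K) (hKU : K ⊆ U)
    (hf : ContDiffOn ℝ n f U) (h0 : ∀ z ∈ U \ K, f z = 0) : ContDiff ℝ n (U.indicator f) := by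
  refine contDiff_iff_contDiffAt.2 fun z => ?_
  by_cases hz : z ∈ U
  · refine (hf.contDiffAt (hU.mem_nhds hz)).congr_of_eventuallyEq ?_
    filter_upwards [hU.mem_nhds hz] with w hw using indicator_of_mem hw f
  · refine (contDiffAt_const (c := (0 : V))).congr_of_eventuallyEq ?_
    filter_upwards [hK.isOpen_compl.mem_nhds fun h => hz (hKU h)] with w hw
    by_cases hwU : w ∈ U
    · rw [indicator_of_mem hwU, h0 w ⟨hwU, hw⟩]
    · rw [indicator_of_notMem hwU]

/-- The Green formula for a compactly supported `1`-form in an open subset of the plane. -/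
theorem setIntegral_antisymm_fderiv_eq_zero {α : ℂ → ℂ →L[ℝ] ℂ} {U K : Set ℂ} (hU : IsOpen U)
    (hK : IsCompact K) (hKU : K ⊆ U) (hα : ContDiffOn ℝ ∞ α U) (h0 : ∀ z ∈ U \ K, α z = 0) :
    ∫ z in U, (fderiv ℝ α z 1 Complex.I - fderiv ℝ α z Complex.I 1) = 0 := by
  set b := U.indicator α with hb
  have hbs : ContDiff ℝ ∞ b := contDiff_indicator hU hK.isClosed hKU hα h0
  have hb0 : ∀ z ∉ K, b z = 0 := fun z hz => by
    by_cases hzU : z ∈ U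
    · rw [hb, indicator_of_mem hzU, h0 z ⟨hzU, hz⟩]
    · rw [hb, indicator_of_notMem hzU]
  have hbc : HasCompactSupport b := HasCompactSupport.intro hK hb0
  have hd : ∀ u v z, fderiv ℝ (fun z => b z v) z u = fderiv ℝ b z u v := fun u v z => by
    have := ((hbs.differentiable (by simp) z).hasFDerivAt.clm_apply (hasFDerivAt_const v z)).fderiv
    rw [this]; simp
  have hv : ∀ v, ContDiff ℝ 1 (fun z => b z v) := fun v =>
    (hbs.clm_apply contDiff_const).of_le (by simp)
  have hvc : ∀ v, HasCompactSupport (fun z => b z v) := fun v =>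
    HasCompactSupport.intro hK fun z hz => by simp [hb0 z hz]
  have hi : ∀ u v, Integrable (fun z => fderiv ℝ b z u v) := fun u v => by
    simp only [← hd]
    exact (((hv v).continuous_fderiv (by simp)).clm_apply
      continuous_const).integrable_of_hasCompactSupport ((hvc v).fderiv_apply (𝕜 := ℝ) (v := u))
  have h1 : ∀ u v, ∫ z, fderiv ℝ b z u v = 0 := fun u v => by
    simp only [← hd]; exact integral_fderiv_eq_zero (hv v) (hvc v) u
  have h2 : ∫ z in U, (fderiv ℝ α z 1 Complex.I - fderiv ℝ α z Complex.I 1)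
      = ∫ z in U, (fderiv ℝ b z 1 Complex.I - fderiv ℝ b z Complex.I 1) := by
    refine setIntegral_congr_fun hU.measurableSet fun z hz => ?_
    have : b =ᶠ[𝓝 z] α := by
      filter_upwards [hU.mem_nhds hz] with w hw using indicator_of_mem hw α
    simp only [this.fderiv_eq]
  rw [h2, setIntegral_eq_integral_of_forall_compl_eq_zero, integral_sub (hi _ _) (hi _ _), h1, h1,
    sub_zero]
  intro z hz
  have : b =ᶠ[𝓝 z] fun _ => 0 := by
    filter_upwards [hK.isClosed.isOpen_compl.mem_nhds fun h => hz (hKU h)] with w hw using hb0 w hw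
  simp [this.fderiv_eq]

end Plane

/-! ### The integral over a compact Riemann surface and the Stokes theorem -/

section Surface

variable {S : Type*} [TopologicalSpace S]

theorem integrableOn_target {F : ℂ → ℂ} {e : OpenPartialHomeomorph S ℂ} {K : Set S}
    (hK : IsCompact K) (hKe : K ⊆ e.source) (hF : ContinuousOn F e.target)
    (h0 : ∀ z ∈ e.target, e.symm z ∉ K → F z = 0) : IntegrableOn F e.target := by
  have hc : IsCompact (e '' K) := hK.image_of_continuousOn (e.continuousOn.mono hKe)
  have hs : e '' K ⊆ e.target := by
    rintro _ ⟨q, hq, rfl⟩; exact e.map_source (hKe hq)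
  refine ((hF.mono hs).integrableOn_compact hc).of_forall_sdiff_eq_zero
    e.open_target.measurableSet fun z hz => h0 z hz.1 fun h => hz.2 ⟨_, h, e.right_inv hz.1⟩

variable [ChartedSpace ℂ S]

/-- A continuous `2`-form. -/
def ContForm (Ω : TwoForm S ℂ) : Prop :=
  ∀ p : S, ContinuousOn (localCoeff (chartAt ℂ p) Ω) (chartAt ℂ p).target

theorem localCoeff_eq_det_mul {Ω : TwoForm S ℂ} {w : S → ℂ}
    (hΩ : ∀ p u v, Ω p u v = (u.re * v.im - u.im * v.re : ℝ) * w p)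
    (e : OpenPartialHomeomorph S ℂ) (z : ℂ) :
    localCoeff e Ω z = (chartDiff e z).det * w (e.symm z) := by
  rw [localCoeff, hΩ, det_eq_re_mul_im_sub]

theorem SmoothForm.contForm_extDer [IsManifold 𝓘(ℝ, ℂ) ∞ S] {α : OneForm S ℂ}
    (hα : SmoothForm α) : ContForm (extDer α) := fun p => by
  have h := (hα p).continuousOn_fderiv_of_isOpen (chartAt ℂ p).open_target (by simp)
  refine ContinuousOn.congr (f := fun z => fderiv ℝ (localRep (chartAt ℂ p) α) z 1 Complex.I
    - fderiv ℝ (localRep (chartAt ℂ p) α) z Complex.I 1) ?_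
    fun z hz => extDer_apply_chartDiff hα (chart_mem_atlas ℂ p) hz _ _
  exact ((h.clm_apply continuousOn_const).clm_apply continuousOn_const).sub
    ((h.clm_apply continuousOn_const).clm_apply continuousOn_const)

/-- Change of variables along the transition map. The substitution rule carries an absolute value of
the Jacobian, which drops out because the transition is holomorphic. -/
theorem setIntegral_chart_eq [IsManifold 𝓘(ℝ, ℂ) ∞ S] [IsManifold 𝓘(ℂ, ℂ) ω S]
    {e e' : OpenPartialHomeomorph S ℂ} (he : e ∈ atlas ℂ S) (he' : e' ∈ atlas ℂ S) {w : S → ℂ}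
    (hw : ∀ q ∉ e.source ∩ e'.source, w q = 0) :
    ∫ z in e.target, (chartDiff e z).det * w (e.symm z)
      = ∫ z in e'.target, (chartDiff e' z).det * w (e'.symm z) := by
  set ψ := e.symm.trans e'
  have hs : ψ.source = e.target ∩ e.symm ⁻¹' e'.source := rfl
  have ht : ψ.target = e'.target ∩ e'.symm ⁻¹' e.source := rfl
  have h1 : ∫ z in e.target, (chartDiff e z).det * w (e.symm z)
      = ∫ z in ψ.source, (chartDiff e z).det * w (e.symm z) := by
    refine setIntegral_eq_of_subset_of_forall_sdiff_eq_zero e.open_target.measurableSet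
      (hs ▸ inter_subset_left) fun z hz => ?_
    rw [hw (e.symm z) fun h => hz.2 ⟨hz.1, h.2⟩, mul_zero]
  have h2 : ∫ z in e'.target, (chartDiff e' z).det * w (e'.symm z)
      = ∫ z in ψ.target, (chartDiff e' z).det * w (e'.symm z) := by
    refine setIntegral_eq_of_subset_of_forall_sdiff_eq_zero e'.open_target.measurableSet
      (ht ▸ inter_subset_left) fun z hz => ?_
    rw [hw (e'.symm z) fun h => hz.2 ⟨hz.1, h.1⟩, mul_zero]
  rw [h1, h2, ← ψ.image_source_eq_target,
    integral_image_eq_integral_abs_det_fderiv_smul volume ψ.open_source.measurableSet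
      (f' := fun z => fderiv ℝ (e' ∘ e.symm) z) ?_ ψ.injOn]
  · refine setIntegral_congr_fun ψ.open_source.measurableSet fun z hz => ?_
    have hd := (contDiffAt_transition (𝕜 := ℂ) (n := ω) he he' hz.1 hz.2).differentiableAt (by simp)
    have hψ : e'.symm (ψ z) = e.symm z := e'.left_inv hz.2
    have hdet : (chartDiff e z).det
        = (chartDiff e' (ψ z)).det * (fderiv ℝ (e' ∘ e.symm) z).det := by
      rw [chartDiff_eq_comp he he' hz.1 hz.2]
      exact LinearMap.det_comp _ _
    rw [abs_of_nonneg (det_fderiv_nonneg hd), hdet, hψ, Complex.real_smul, Complex.ofReal_mul]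
    ring
  · intro z hz
    exact ((contDiffAt_transition (𝕜 := ℝ) (n := ∞) he he' hz.1 hz.2).differentiableAt
      (by simp)).hasFDerivAt.hasFDerivWithinAt

variable [T2Space S] [CompactSpace S] [IsManifold 𝓘(ℂ, ℂ) ω S]

theorem tsupport_chartPartition_subset (p : S) :
    tsupport (chartPartition S p) ⊆ (chartAt ℂ p).source :=
  (exists_chartPartition S).choose_spec p

variable (S) in
theorem finite_chartPartition : {p : S | ∃ q, chartPartition S p q ≠ 0}.Finite :=
  (chartPartition S).locallyFinite.finite_nonempty_of_compact

theorem smoothFun_chartPartition [IsManifold 𝓘(ℝ, ℂ) ∞ S] (p : S) :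
    SmoothFun (chartPartition S p) :=
  smoothFun_of_contMDiff (chartPartition S p).contMDiff

variable (S) in
/-- The indices of the nonzero members of the partition of unity. -/
def partitionIndex : Finset S := (finite_chartPartition S).toFinset

theorem chartPartition_eq_zero {p : S} (hp : p ∉ partitionIndex S) (q : S) :
    chartPartition S p q = 0 := by
  by_contra h
  exact hp ((finite_chartPartition S).mem_toFinset.2 ⟨q, h⟩)

theorem sum_chartPartition (q : S) : ∑ p ∈ partitionIndex S, chartPartition S p q = 1 := by
  rw [← (chartPartition S).sum_eq_one (mem_univ q)]
  refine (finsum_eq_sum_of_support_subset _ fun p hp => ?_).symm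
  by_contra h
  exact hp (chartPartition_eq_zero h q)

theorem surfaceIntegral_eq_sum (Ω : TwoForm S ℂ) :
    surfaceIntegral Ω = ∑ p ∈ partitionIndex S, ∫ z in (chartAt ℂ p).target,
      (chartPartition S p ((chartAt ℂ p).symm z) : ℂ) * localCoeff (chartAt ℂ p) Ω z := by
  refine finsum_eq_sum_of_support_subset _ fun p hp => ?_
  by_contra h
  exact hp (by simp [chartPartition_eq_zero h])

theorem continuousOn_chartPartition (p q : S) :
    ContinuousOn (fun z => (chartPartition S q ((chartAt ℂ p).symm z) : ℂ))
      (chartAt ℂ p).target :=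
  (Complex.continuous_ofReal.comp (chartPartition S q).contMDiff.continuous).comp_continuousOn
    (chartAt ℂ p).continuousOn_symm

theorem ContForm.integrableOn {Ω : TwoForm S ℂ} (hΩ : ContForm Ω) (p : S) :
    IntegrableOn (fun z => (chartPartition S p ((chartAt ℂ p).symm z) : ℂ)
      * localCoeff (chartAt ℂ p) Ω z) (chartAt ℂ p).target := by
  refine integrableOn_target (isClosed_tsupport (chartPartition S p)).isCompact
    (tsupport_chartPartition_subset p) ((continuousOn_chartPartition p p).mul (hΩ p))
    fun z _ h => ?_
  simp [image_eq_zero_of_notMem_tsupport h]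

theorem surfaceIntegral_add {Ω Ω' : TwoForm S ℂ} (h : ContForm Ω) (h' : ContForm Ω') :
    surfaceIntegral (Ω + Ω') = surfaceIntegral Ω + surfaceIntegral Ω' := by
  simp only [surfaceIntegral_eq_sum, ← Finset.sum_add_distrib]
  refine Finset.sum_congr rfl fun p _ => ?_
  rw [← integral_add (h.integrableOn p) (h'.integrableOn p)]
  refine integral_congr_ae (Eventually.of_forall fun z => ?_)
  simp [localCoeff, mul_add]

/-- The part of a `1`-form cut out by a member of the partition of unity. -/
def cutForm (p : S) (α : OneForm S ℂ) : OneForm S ℂ :=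
  bilinForm (ContinuousLinearMap.lsmul ℝ ℝ) (chartPartition S p) α

theorem sum_cutForm (α : OneForm S ℂ) : ∑ p ∈ partitionIndex S, cutForm p α = α := by
  funext q
  ext1 v
  simp [cutForm, bilinForm, Finset.sum_apply, ← Finset.sum_mul, ← Complex.ofReal_sum,
    sum_chartPartition]

/-- A continuous `2`-form with nonnegative coefficients and vanishing integral is zero. -/
theorem localCoeff_eq_zero_of_surfaceIntegral_eq_zero {Ω : TwoForm S ℂ} (hΩ : ContForm Ω)
    (hnn : ∀ (p : S), ∀ z ∈ (chartAt ℂ p).target, ∃ r : ℝ, 0 ≤ r ∧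
      localCoeff (chartAt ℂ p) Ω z = r)
    (h0 : surfaceIntegral Ω = 0) (q : S) :
    ∃ p : S, q ∈ (chartAt ℂ p).source ∧ localCoeff (chartAt ℂ p) Ω (chartAt ℂ p q) = 0 := by
  obtain ⟨p, hp, hpq⟩ : ∃ p ∈ partitionIndex S, chartPartition S p q ≠ 0 := by
    by_contra! h
    simpa [Finset.sum_eq_zero h] using sum_chartPartition q
  have hq : q ∈ (chartAt ℂ p).source :=
    tsupport_chartPartition_subset p (subset_tsupport _ hpq)
  refine ⟨p, hq, ?_⟩
  set F : S → ℂ → ℝ := fun p z => chartPartition S p ((chartAt ℂ p).symm z)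
    * (localCoeff (chartAt ℂ p) Ω z).re
  have hre : ∀ p, ∀ z ∈ (chartAt ℂ p).target, 0 ≤ (localCoeff (chartAt ℂ p) Ω z).re ∧
      localCoeff (chartAt ℂ p) Ω z = (localCoeff (chartAt ℂ p) Ω z).re := fun p z hz => by
    obtain ⟨r, hr, h⟩ := hnn p z hz
    rw [h]; simpa using hr
  have hF : ∀ p, ∫ z in (chartAt ℂ p).target, (chartPartition S p ((chartAt ℂ p).symm z) : ℂ)
      * localCoeff (chartAt ℂ p) Ω z = ((∫ z in (chartAt ℂ p).target, F p z : ℝ) : ℂ) := fun p => by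
    rw [← integral_complex_ofReal]
    refine setIntegral_congr_fun (chartAt ℂ p).open_target.measurableSet fun z hz => ?_
    simp only [F]
    rw [(hre p z hz).2]
    simp
  have hFnn : ∀ p, ∀ z ∈ (chartAt ℂ p).target, 0 ≤ F p z := fun p z hz =>
    mul_nonneg ((chartPartition S).nonneg p _) (hre p z hz).1
  have hsum : ∑ p ∈ partitionIndex S, ∫ z in (chartAt ℂ p).target, F p z = 0 := by
    rw [surfaceIntegral_eq_sum, Finset.sum_congr rfl fun p _ => hF p] at h0
    exact_mod_cast h0
  have hzero : ∫ z in (chartAt ℂ p).target, F p z = 0 :=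
    -- A vanishing sum of nonnegative integrals has vanishing summands, in particular the one whose
    -- cutoff is nonzero at q.
    (Finset.sum_eq_zero_iff_of_nonneg fun p _ =>
      setIntegral_nonneg (chartAt ℂ p).open_target.measurableSet (hFnn p)).1 hsum p hp
  have hcont : ContinuousOn (F p) (chartAt ℂ p).target :=
    ((chartPartition S p).contMDiff.continuous.comp_continuousOn
      (chartAt ℂ p).continuousOn_symm).mul (Complex.continuous_re.comp_continuousOn (hΩ p))
  have hint : IntegrableOn (F p) (chartAt ℂ p).target := by
    have := (hΩ.integrableOn p).re
    refine this.congr (Eventually.of_forall fun z => ?_)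
    simp [F]
  have hae := (setIntegral_eq_zero_iff_of_nonneg_ae
    ((ae_restrict_iff' (chartAt ℂ p).open_target.measurableSet).2
      (Eventually.of_forall (hFnn p))) hint).1 hzero
  -- Continuity upgrades vanishing almost everywhere to vanishing at the image of q, where the
  -- cutoff can be divided out.
  have := Measure.eqOn_open_of_ae_eq hae (chartAt ℂ p).open_target hcont continuousOn_const
    ((chartAt ℂ p).map_source hq)
  simp only [F, (chartAt ℂ p).left_inv hq, Pi.zero_apply, mul_eq_zero, hpq, false_or] at this
  rw [(hre p _ ((chartAt ℂ p).map_source hq)).2, this, Complex.ofReal_zero]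

variable [IsManifold 𝓘(ℝ, ℂ) ∞ S]

/-- A form supported in a chart domain can be integrated in that chart. -/
theorem surfaceIntegral_eq_setIntegral {Ω : TwoForm S ℂ} (hc : ContForm Ω) {w : S → ℂ}
    (hΩ : ∀ p u v, Ω p u v = (u.re * v.im - u.im * v.re : ℝ) * w p) (p : S) {K : Set S}
    (hK : IsCompact K) (hKp : K ⊆ (chartAt ℂ p).source) (hw : ∀ q ∉ K, w q = 0) :
    surfaceIntegral Ω = ∫ z in (chartAt ℂ p).target, localCoeff (chartAt ℂ p) Ω z := by
  -- The weight ρ_q w vanishes off the overlap of the two chart domains, so each piece can be moved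
  -- to the chart at p, where the cutoffs sum to 1.
  have h1 : ∀ q : S, ∫ z in (chartAt ℂ q).target,
      (chartPartition S q ((chartAt ℂ q).symm z) : ℂ) * localCoeff (chartAt ℂ q) Ω z
      = ∫ z in (chartAt ℂ p).target,
        (chartPartition S q ((chartAt ℂ p).symm z) : ℂ) * localCoeff (chartAt ℂ p) Ω z := by
    intro q
    have h := setIntegral_chart_eq (chart_mem_atlas ℂ q) (chart_mem_atlas ℂ p)
      (w := fun r => (chartPartition S q r : ℂ) * w r) fun r hr => ?_
    · simp only [localCoeff_eq_det_mul hΩ]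
      convert h using 3 <;> ring
    · by_cases hrK : r ∈ K
      · have : chartPartition S q r = 0 := image_eq_zero_of_notMem_tsupport fun h =>
          hr ⟨tsupport_chartPartition_subset q h, hKp hrK⟩
        simp [this]
      · simp [hw r hrK]
  rw [surfaceIntegral_eq_sum, Finset.sum_congr rfl fun q _ => h1 q, ← integral_finsetSum]
  · refine integral_congr_ae (Eventually.of_forall fun z => ?_)
    simp only [← Finset.sum_mul, ← Complex.ofReal_sum, sum_chartPartition, Complex.ofReal_one,
      one_mul]
  · intro q _
    refine integrableOn_target hK hKp ((continuousOn_chartPartition p q).mul (hc p)) fun z _ h => ?_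
    rw [localCoeff_eq_det_mul hΩ, hw _ h, mul_zero, mul_zero]

theorem SmoothForm.cut {α : OneForm S ℂ} (hα : SmoothForm α) (p : S) : SmoothForm (cutForm p α) :=
  (smoothFun_chartPartition p).smoothForm_bilinForm hα _

/-- The cut form is supported in a compact subset of one chart domain, so its integral is planar and
the Green formula applies. -/
theorem surfaceIntegral_extDer_cutForm {α : OneForm S ℂ} (hα : SmoothForm α) (p : S) :
    surfaceIntegral (extDer (cutForm p α)) = 0 := by
  set e := chartAt ℂ p
  have hK : IsCompact (tsupport (chartPartition S p)) :=
    (isClosed_tsupport (chartPartition S p)).isCompact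
  have hKe := tsupport_chartPartition_subset p
  rw [surfaceIntegral_eq_setIntegral (hα.cut p).contForm_extDer
    (w := fun q => extDer (cutForm p α) q 1 Complex.I) ?_ p hK hKe ?_]
  · refine (setIntegral_congr_fun e.open_target.measurableSet fun z hz =>
      extDer_apply_chartDiff (hα.cut p) (chart_mem_atlas ℂ p) hz 1 Complex.I).trans ?_
    refine setIntegral_antisymm_fderiv_eq_zero e.open_target
      (hK.image_of_continuousOn (e.continuousOn.mono hKe)) ?_ (hα.cut p p) fun z hz => ?_
    · rintro _ ⟨q, hq, rfl⟩; exact e.map_source (hKe hq)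
    · have : chartPartition S p (e.symm z) = 0 := image_eq_zero_of_notMem_tsupport fun h =>
        hz.2 ⟨_, h, e.right_inv hz.1⟩
      simp [localRep, cutForm, bilinForm, e, this]
  · intro q u v
    exact antisymm_eq_smul _ u v
  · intro q hq
    have hev : localRep (chartAt ℂ q) (cutForm p α) =ᶠ[𝓝 (chartAt ℂ q q)] fun _ => 0 := by
      have h1 : ∀ᶠ r in 𝓝 q, chartPartition S p r = 0 :=
        (notMem_tsupport_iff_eventuallyEq.1 hq)
      have h2 : Tendsto (chartAt ℂ q).symm (𝓝 (chartAt ℂ q q)) (𝓝 q) := by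
        have := (chartAt ℂ q).continuousAt_symm (mem_chart_target ℂ q)
        rwa [ContinuousAt, (chartAt ℂ q).left_inv (mem_chart_source ℂ q)] at this
      filter_upwards [h2.eventually h1] with z hz
      simp [localRep, cutForm, bilinForm, hz]
    simp [extDer, hev.fderiv_eq]

/-- The Stokes theorem on a compact Riemann surface. -/
theorem surfaceIntegral_extDer {α : OneForm S ℂ} (hα : SmoothForm α) :
    surfaceIntegral (extDer α) = 0 := by
  classical
  have h : ∀ s : Finset S, SmoothForm (∑ p ∈ s, cutForm p α) ∧
      surfaceIntegral (extDer (∑ p ∈ s, cutForm p α)) = 0 := by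
    intro s
    induction s using Finset.induction_on with
    | empty =>
      have h0 : ∀ e : OpenPartialHomeomorph S ℂ, localRep e (0 : OneForm S ℂ) = fun _ => 0 :=
        fun e => by funext z; simp [localRep]
      refine ⟨fun p => ?_, ?_⟩
      · rw [Finset.sum_empty, h0]; exact contDiffOn_const
      · have : extDer (0 : OneForm S ℂ) = 0 := by funext p u v; simp [extDer, h0]
        rw [Finset.sum_empty, this]
        simp [surfaceIntegral, localCoeff]
    | insert p s hp ih =>
      rw [Finset.sum_insert hp]
      refine ⟨(hα.cut p).add ih.1, ?_⟩
      rw [extDer_add (hα.cut p) ih.1, surfaceIntegral_add (hα.cut p).contForm_extDer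
        ih.1.contForm_extDer, surfaceIntegral_extDer_cutForm hα, ih.2, add_zero]
  have := (h (partitionIndex S)).2
  rwa [sum_cutForm] at this

end Surface

/-! ### Matrix-valued functions and forms -/

section MatrixForms

variable {S : Type*}

/-- The trace as a continuous `ℝ`-linear map. -/
def traceCLM : Mat →L[ℝ] ℂ := LinearMap.toContinuousLinearMap (Matrix.traceLinearMap (Fin 2) ℝ ℂ)

@[simp] theorem traceCLM_apply (a : Mat) : traceCLM a = a.trace := rfl

/-- The product of a matrix-valued function and a matrix-valued `1`-form. -/
def lmulForm (f : S → Mat) (α : OneForm S Mat) : OneForm S Mat :=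
  bilinForm (ContinuousLinearMap.mul ℝ Mat) f α

/-- The product of a matrix-valued `1`-form and a matrix-valued function. -/
def rmulForm (α : OneForm S Mat) (f : S → Mat) : OneForm S Mat :=
  bilinForm (ContinuousLinearMap.mul ℝ Mat).flip f α

@[simp] theorem lmulForm_apply (f : S → Mat) (α : OneForm S Mat) (p : S) (v : ℂ) :
    lmulForm f α p v = f p * α p v := rfl

@[simp] theorem rmulForm_apply (α : OneForm S Mat) (f : S → Mat) (p : S) (v : ℂ) :
    rmulForm α f p v = α p v * f p := rfl

variable [TopologicalSpace S] [ChartedSpace ℂ S]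

theorem SmoothForm.lmul {f : S → Mat} {α : OneForm S Mat} (hα : SmoothForm α) (hf : SmoothFun f) :
    SmoothForm (lmulForm f α) := hf.smoothForm_bilinForm hα _

theorem SmoothForm.rmul {f : S → Mat} {α : OneForm S Mat} (hα : SmoothForm α) (hf : SmoothFun f) :
    SmoothForm (rmulForm α f) := hf.smoothForm_bilinForm hα _

theorem SmoothFun.sub {f g : S → Mat} (hf : SmoothFun f) (hg : SmoothFun g) :
    SmoothFun (f - g) := fun p => (hf p).sub (hg p)

theorem SmoothFun.mul {f g : S → Mat} (hf : SmoothFun f) (hg : SmoothFun g) :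
    SmoothFun (f * g) := fun p => (hf p).mul (hg p)

theorem SmoothFun.const_smul {f : S → Mat} (hf : SmoothFun f) (r : ℝ) : SmoothFun (r • f) :=
  fun p => (hf p).const_smul r

/-- The matrix inverse agrees with `Ring.inverse`, which is smooth at units of a complete normed
algebra. -/
theorem contDiffAt_matrix_inv {a : Mat} (ha : a.det = 1) :
    ContDiffAt ℝ ∞ (fun x : Mat => x⁻¹) a := by
  have hu : IsUnit a := (Matrix.isUnit_iff_isUnit_det a).2 (by simp [ha])
  obtain ⟨x, rfl⟩ := hu
  have h := contDiffAt_ringInverse ℝ (n := ∞) x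
  exact h.congr_of_eventuallyEq
    (Eventually.of_forall fun y => Matrix.nonsing_inv_eq_ringInverse y)

theorem SmoothFun.inv {g : S → Mat} (hg : SmoothFun g) (hdet : ∀ p, (g p).det = 1) :
    SmoothFun fun p => (g p)⁻¹ := fun p z hz =>
  ContDiffAt.comp_contDiffWithinAt (f := g ∘ (chartAt ℂ p).symm) z
    (contDiffAt_matrix_inv (hdet _)) (hg p z hz)

theorem inv_mul_self {a : Mat} (h : a.det = 1) : a⁻¹ * a = 1 :=
  Matrix.nonsing_inv_mul a (by simp [h])

theorem mul_inv_self {a : Mat} (h : a.det = 1) : a * a⁻¹ = 1 :=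
  Matrix.mul_nonsing_inv a (by simp [h])

theorem contForm_trace_wedge {α β : OneForm S Mat} (hα : SmoothForm α) (hβ : SmoothForm β) :
    ContForm fun p u v => (wedge α β p u v).trace := fun p => by
  have h1 : ∀ v : ℂ, ContinuousOn (fun z => localRep (chartAt ℂ p) α z v) (chartAt ℂ p).target :=
    fun v => (hα p).continuousOn.clm_apply continuousOn_const
  have h2 : ∀ v : ℂ, ContinuousOn (fun z => localRep (chartAt ℂ p) β z v) (chartAt ℂ p).target :=
    fun v => (hβ p).continuousOn.clm_apply continuousOn_const
  exact traceCLM.continuous.comp_continuousOn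
    (((h1 1).mul (h2 Complex.I)).sub ((h1 Complex.I).mul (h2 1)))

variable [IsManifold 𝓘(ℝ, ℂ) ∞ S]

theorem differential_sub {f g : S → Mat} (hf : SmoothFun f) (hg : SmoothFun g) :
    differential (f - g) = differential f - differential g := by
  funext p
  have hz := mem_chart_target ℂ p
  rw [Pi.sub_apply, differential_eq hf, differential_eq hg, differential_eq (hf.sub hg)]
  exact fderiv_sub (hf.differentiableAt p hz) (hg.differentiableAt p hz)

theorem differential_const_smul {f : S → Mat} (hf : SmoothFun f) (r : ℝ) :
    differential (r • f) = r • differential f := by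
  funext p
  have hz := mem_chart_target ℂ p
  rw [Pi.smul_apply, differential_eq hf, differential_eq (hf.const_smul r)]
  exact fderiv_const_smul (hf.differentiableAt p hz) r

theorem differential_mul {f g : S → Mat} (hf : SmoothFun f) (hg : SmoothFun g) :
    differential (f * g) = lmulForm f (differential g) + rmulForm (differential f) g := by
  funext p
  have hz := mem_chart_target ℂ p
  have h := ((hf.differentiableAt p hz).hasFDerivAt.mul' (hg.differentiableAt p hz).hasFDerivAt)
  have h' := h.fderiv
  have hp := (chartAt ℂ p).left_inv (mem_chart_source ℂ p)
  ext1 v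
  rw [Pi.add_apply, _root_.add_apply, lmulForm_apply, rmulForm_apply, differential_eq hf,
    differential_eq hg, differential_eq (hf.mul hg)]
  refine (congrArg (fun L => L v) h').trans ?_
  simp [hp]

theorem extDer_lmulForm {f : S → Mat} {α : OneForm S Mat} (hf : SmoothFun f) (hα : SmoothForm α)
    (p : S) (u v : ℂ) : extDer (lmulForm f α) p u v
      = wedge (differential f) α p u v + f p * extDer α p u v := by
  rw [lmulForm, extDer_bilinForm hf hα, ← differential_eq hf]
  rfl

theorem extDer_rmulForm {f : S → Mat} {α : OneForm S Mat} (hf : SmoothFun f) (hα : SmoothForm α)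
    (p : S) (u v : ℂ) : extDer (rmulForm α f) p u v
      = extDer α p u v * f p - wedge α (differential f) p u v := by
  rw [rmulForm, extDer_bilinForm hf hα, ← differential_eq hf, wedge]
  simp only [ContinuousLinearMap.flip_apply, ContinuousLinearMap.mul_apply']
  abel

/-! ### Gauge transformation of closed forms -/

/-- The conjugate `g⁻¹ α g` of a matrix-valued `1`-form. -/
def adForm (g : S → Mat) (α : OneForm S Mat) : OneForm S Mat :=
  lmulForm (fun p => (g p)⁻¹) (rmulForm α g)

/-- Differentiate g⁻¹ g = 1. -/
theorem differential_inv_apply {g : S → Mat} (hg : SmoothFun g) (hdet : ∀ p, (g p).det = 1)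
    (p : S) (v : ℂ) :
    differential (fun p => (g p)⁻¹) p v = -((g p)⁻¹ * differential g p v * (g p)⁻¹) := by
  have h := congrFun (differential_mul (hg.inv hdet) hg) p
  have h1 : ((fun p => (g p)⁻¹) * g : S → Mat) = fun _ => 1 := by
    funext q; exact inv_mul_self (hdet q)
  have h0 : differential (fun _ : S => (1 : Mat)) p = 0 := mfderiv_const
  rw [h1, h0] at h
  have h2 := congrArg (fun L => L v * (g p)⁻¹) h
  simp only [_root_.zero_apply, zero_mul, Pi.add_apply, _root_.add_apply, lmulForm_apply,
    rmulForm_apply, add_mul, mul_assoc, mul_inv_self (hdet p), mul_one] at h2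
  rw [mul_assoc]
  exact eq_neg_of_add_eq_zero_right h2.symm

/-- Gauge covariance: g⁻¹dg is the connection form of d.g, so its covariant derivative is d
conjugated by g. The terms containing dg cancel. -/
theorem covExtDer_adForm {g : S → Mat} (hg : SmoothFun g) (hdet : ∀ p, (g p).det = 1)
    {α : OneForm S Mat} (hα : SmoothForm α) (p : S) (u v : ℂ) :
    covExtDer (lmulForm (fun p => (g p)⁻¹) (differential g)) (adForm g α) p u v
      = (g p)⁻¹ * extDer α p u v * g p := by
  have h : ∀ w : Mat, g p * ((g p)⁻¹ * w) = w := fun w => by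
    rw [← mul_assoc, mul_inv_self (hdet p), one_mul]
  simp only [covExtDer, Pi.add_apply, adForm, extDer_lmulForm (hg.inv hdet) (hα.rmul hg),
    extDer_rmulForm hg hα, wedge, differential_inv_apply hg hdet, lmulForm_apply, rmulForm_apply,
    mul_assoc, h]
  noncomm_ring

theorem extDer_eq_zero_of_covExtDer_adForm {g : S → Mat} (hg : SmoothFun g)
    (hdet : ∀ p, (g p).det = 1) {α : OneForm S Mat} (hα : SmoothForm α)
    (h : covExtDer (lmulForm (fun p => (g p)⁻¹) (differential g)) (adForm g α) = 0) :
    extDer α = 0 := by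
  funext p u v
  have h1 := covExtDer_adForm hg hdet hα p u v
  rw [h] at h1
  have h2 := congrArg (fun a => g p * a * (g p)⁻¹) h1
  simp only [Pi.zero_apply, mul_zero, zero_mul, mul_assoc, mul_inv_self (hdet p), mul_one] at h2
  rw [← mul_assoc, mul_inv_self (hdet p), one_mul] at h2
  exact h2.symm

end MatrixForms

/-! ### Harmonic functions on a compact Riemann surface -/

section Harmonic

variable {S : Type*} [TopologicalSpace S] [ChartedSpace ℂ S] [IsManifold 𝓘(ℂ, ℂ) ω S]
  [IsManifold 𝓘(ℝ, ℂ) ∞ S]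

/-- Charts are holomorphic, so their real differentials commute with the complex structure. This
makes ⋆ computable in any chart. -/
theorem chartDiff_I_mul {e : OpenPartialHomeomorph S ℂ} (he : e ∈ atlas ℂ S) {z : ℂ}
    (hz : z ∈ e.target) (v : ℂ) :
    chartDiff e z (Complex.I * v) = Complex.I * chartDiff e z v := by
  have hs := mem_chart_source ℂ (e.symm z)
  have hd := (contDiffAt_transition (𝕜 := ℂ) (n := ω) he (chart_mem_atlas ℂ (e.symm z)) hz
    hs).differentiableAt (by simp)
  rw [chartDiff_eq_comp he (chart_mem_atlas ℂ (e.symm z)) hz hs, chartDiff_chartAt,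
    hd.fderiv_restrictScalars ℝ]
  simpa using (fderiv ℂ (chartAt ℂ (e.symm z) ∘ e.symm) z).map_smul Complex.I v

variable {V : Type*} [NormedAddCommGroup V] [NormedSpace ℝ V]

theorem SmoothForm.hodgeStar {α : OneForm S V} (hα : SmoothForm α) : SmoothForm (hodgeStar α) := by
  intro p
  refine (((hα p).clm_comp contDiffOn_const).neg).congr
    (f := fun z => -(localRep (chartAt ℂ p) α z).comp (ContinuousLinearMap.mul ℝ ℂ Complex.I))
    fun z hz => ?_
  ext1 v
  simp [localRep, FlatFamily.hodgeStar, chartDiff_I_mul (chart_mem_atlas ℂ p) hz]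

/-- The pairing `(a, b) ↦ aᴴ b`. -/
def conjMul : Mat →L[ℝ] Mat →L[ℝ] Mat :=
  (ContinuousLinearMap.mul ℝ Mat).comp (LinearMap.toContinuousLinearMap
    { toFun := fun a : Mat => a.conjTranspose
      map_add' := Matrix.conjTranspose_add
      map_smul' := fun r a => by ext i j; simp })

@[simp] theorem conjMul_apply (a b : Mat) : conjMul a b = a.conjTranspose * b := rfl

theorem trace_conjTranspose_mul_self (a : Mat) :
    (a.conjTranspose * a).trace = ((∑ i, ∑ j, Complex.normSq (a j i) : ℝ) : ℂ) := by
  simp [Matrix.trace, Matrix.mul_apply, Complex.normSq_eq_conj_mul_self]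

theorem sum_normSq_nonneg (a : Mat) : 0 ≤ ∑ i, ∑ j, Complex.normSq (a j i) :=
  Finset.sum_nonneg fun _ _ => Finset.sum_nonneg fun _ _ => Complex.normSq_nonneg _

theorem eq_zero_of_sum_normSq {a : Mat} (h : ∑ i, ∑ j, Complex.normSq (a j i) = 0) : a = 0 := by
  ext i j
  have h1 := (Finset.sum_eq_zero_iff_of_nonneg fun _ _ =>
    Finset.sum_nonneg fun _ _ => Complex.normSq_nonneg _).1 h j (Finset.mem_univ j)
  have h2 := (Finset.sum_eq_zero_iff_of_nonneg fun _ _ =>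
    Complex.normSq_nonneg _).1 h1 i (Finset.mem_univ i)
  exact Complex.normSq_eq_zero.1 h2

/-- Harmonic functions on a compact Riemann surface have vanishing differential. -/
theorem differential_eq_zero_of_harmonic [T2Space S] [CompactSpace S] {f : S → Mat}
    (hf : SmoothFun f) (h : extDer (hodgeStar (differential f)) = 0) : differential f = 0 := by
  have hst := hf.smoothForm_differential.hodgeStar
  have hθ := hf.smoothForm_bilinForm hst conjMul
  -- Ω = d tr(fᴴ ⋆df). Since d⋆df = 0, the Leibniz rule leaves the energy density |∂ₓf|² + |∂ᵧf|²,
  -- whose integral vanishes by Stokes.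
  set Ω := extDer (mapForm traceCLM (bilinForm conjMul f (hodgeStar (differential f)))) with hΩ
  have hcoef : ∀ p : S, ∀ z ∈ (chartAt ℂ p).target, localCoeff (chartAt ℂ p) Ω z
      = ((∑ i, ∑ j, Complex.normSq (localRep (chartAt ℂ p) (differential f) z 1 j i)
        + ∑ i, ∑ j, Complex.normSq
            (localRep (chartAt ℂ p) (differential f) z Complex.I j i) : ℝ) : ℂ) := by
    intro p z hz
    have hI := chartDiff_I_mul (chart_mem_atlas ℂ p) hz 1
    rw [mul_one] at hI
    rw [Complex.ofReal_add, ← trace_conjTranspose_mul_self, ← trace_conjTranspose_mul_self,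
      localCoeff, hΩ, extDer_mapForm hθ, extDer_bilinForm hf hst, h, ← differential_eq hf]
    simp only [localRep, ContinuousLinearMap.comp_apply, hI, hodgeStar, conjMul_apply,
      _root_.neg_apply, ContinuousLinearMap.mul_apply', ← mul_assoc, Complex.I_mul_I,
      Pi.zero_apply, mul_zero, add_zero, traceCLM_apply, neg_mul, one_mul,
      map_neg, neg_neg, sub_neg_eq_add]
    exact Matrix.trace_add _ _
  funext q
  obtain ⟨p, hq, hp⟩ := localCoeff_eq_zero_of_surfaceIntegral_eq_zero
    (hθ.map traceCLM).contForm_extDer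
    (fun p z hz => ⟨_, add_nonneg (sum_normSq_nonneg _) (sum_normSq_nonneg _), hcoef p z hz⟩)
    (surfaceIntegral_extDer (hθ.map traceCLM)) q
  have hz := (chartAt ℂ p).map_source hq
  have h0 := (hcoef p _ hz).symm.trans hp
  rw [Complex.ofReal_eq_zero,
    add_eq_zero_iff_of_nonneg (sum_normSq_nonneg _) (sum_normSq_nonneg _)] at h0
  have h1 := eq_zero_of_sum_normSq h0.1
  have h2 := eq_zero_of_sum_normSq h0.2
  have h3 : localRep (chartAt ℂ p) (differential f) (chartAt ℂ p q) = 0 := by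
    ext1 v
    have hv : v = v.re • (1 : ℂ) + v.im • Complex.I := by simp [Complex.re_add_im]
    rw [hv, map_add, map_smul, map_smul, h1, h2]
    simp
  -- The vanishing was obtained in the chart at p; it is carried to the preferred chart of q, in
  -- which the value at q is read.
  have hqs := mem_chart_source ℂ q
  have hql := (chartAt ℂ q).left_inv hqs
  rw [← localRep_chartAt (differential f) q, localRep_eq_comp (chart_mem_atlas ℂ q)
    (chart_mem_atlas ℂ p) _ (mem_chart_target ℂ q) (by rwa [hql]), hql, h3]
  simp

end Harmonic

/-! ### Derivatives with respect to the parameter -/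

section Parameter

variable {V : Type*} [NormedAddCommGroup V] [NormedSpace ℝ V] {F : ℝ × ℂ → V} {I : Set ℝ}
  {U : Set ℂ}

theorem deriv_left_eq {x : ℝ × ℂ} (h : DifferentiableAt ℝ F x) :
    deriv (fun t => F (t, x.2)) x.1 = fderiv ℝ F x (1, 0) := by
  have h1 : HasDerivAt (fun t : ℝ => (t, x.2)) ((1 : ℝ), (0 : ℂ)) x.1 :=
    (hasDerivAt_id x.1).prodMk (hasDerivAt_const x.1 x.2)
  exact (HasFDerivAt.comp_hasDerivAt x.1 (f := fun t : ℝ => (t, x.2)) h.hasFDerivAt h1).deriv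

theorem fderiv_right_eq {x : ℝ × ℂ} (h : DifferentiableAt ℝ F x) :
    fderiv ℝ (fun w => F (x.1, w)) x.2 = (fderiv ℝ F x).comp (ContinuousLinearMap.inr ℝ ℝ ℂ) :=
  (HasFDerivAt.comp x.2 (f := fun w : ℂ => (x.1, w)) h.hasFDerivAt
    (hasFDerivAt_prodMk_right x.1 x.2)).fderiv

theorem contDiffOn_deriv_left (hI : IsOpen I) (hU : IsOpen U) (hF : ContDiffOn ℝ ∞ F (I ×ˢ U)) :
    ContDiffOn ℝ ∞ (fun x : ℝ × ℂ => deriv (fun t => F (t, x.2)) x.1) (I ×ˢ U) := by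
  have ho := hI.prod hU
  refine ((hF.fderiv_of_isOpen (m := ∞) ho (by simp)).clm_apply
    (contDiffOn_const (c := ((1 : ℝ), (0 : ℂ))))).congr fun x hx => ?_
  exact deriv_left_eq ((hF.contDiffAt (ho.mem_nhds hx)).differentiableAt (by simp))

theorem contDiffOn_fderiv_right (hI : IsOpen I) (hU : IsOpen U)
    (hF : ContDiffOn ℝ ∞ F (I ×ˢ U)) {z : ℂ} (hz : z ∈ U) :
    ContDiffOn ℝ ∞ (fun t => fderiv ℝ (fun w => F (t, w)) z) I := by
  have ho := hI.prod hU
  have h1 : ContDiffOn ℝ ∞ (fun t : ℝ => fderiv ℝ F (t, z)) I :=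
    (hF.fderiv_of_isOpen (m := ∞) ho (by simp)).comp
      (contDiff_id.prodMk contDiff_const).contDiffOn fun t ht => ⟨ht, hz⟩
  exact (h1.clm_comp contDiffOn_const).congr fun t ht =>
    fderiv_right_eq (x := (t, z))
      ((hF.contDiffAt (ho.mem_nhds ⟨ht, hz⟩)).differentiableAt (by simp))

/-- Derivatives in the parameter and in the point commute. -/
theorem hasDerivAt_fderiv_right (hI : IsOpen I) (hU : IsOpen U)
    (hF : ContDiffOn ℝ ∞ F (I ×ˢ U)) {τ : ℝ} (hτ : τ ∈ I) {z : ℂ} (hz : z ∈ U) :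
    HasDerivAt (fun t => fderiv ℝ (fun w => F (t, w)) z)
      (fderiv ℝ (fun w => deriv (fun t => F (t, w)) τ) z) τ := by
  have ho := hI.prod hU
  have hd : ∀ x ∈ I ×ˢ U, DifferentiableAt ℝ F x := fun x hx =>
    (hF.contDiffAt (ho.mem_nhds hx)).differentiableAt (by simp)
  have hx : (τ, z) ∈ I ×ˢ U := ⟨hτ, hz⟩
  have hF1 := hF.contDiffAt (ho.mem_nhds hx)
  have hF2 : HasFDerivAt (fderiv ℝ F) (fderiv ℝ (fderiv ℝ F) (τ, z)) (τ, z) :=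
    ((hF1.fderiv_right (m := ∞) (by simp)).differentiableAt (by simp)).hasFDerivAt
  have hs : IsSymmSndFDerivAt ℝ F (τ, z) := hF1.isSymmSndFDerivAt (by simpa using ENat.LEInfty.out)
  have h1 : HasDerivAt (fun t : ℝ => (t, z)) ((1 : ℝ), (0 : ℂ)) τ :=
    (hasDerivAt_id τ).prodMk (hasDerivAt_const τ z)
  have h2 : HasDerivAt (fun t => fderiv ℝ F (t, z)) (fderiv ℝ (fderiv ℝ F) (τ, z) (1, 0)) τ :=
    HasFDerivAt.comp_hasDerivAt τ (f := fun t : ℝ => (t, z)) hF2 h1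
  have h3 : HasFDerivAt (fun w => fderiv ℝ F (τ, w))
      ((fderiv ℝ (fderiv ℝ F) (τ, z)).comp (ContinuousLinearMap.inr ℝ ℝ ℂ)) z :=
    HasFDerivAt.comp z (f := fun w : ℂ => (τ, w)) hF2 (hasFDerivAt_prodMk_right τ z)
  have h4 : (fun w => deriv (fun t => F (t, w)) τ) =ᶠ[𝓝 z] fun w => fderiv ℝ F (τ, w) (1, 0) := by
    filter_upwards [hU.mem_nhds hz] with w hw using deriv_left_eq (x := (τ, w)) (hd _ ⟨hτ, hw⟩)
  have h5 : (fun t => fderiv ℝ (fun w => F (t, w)) z) =ᶠ[𝓝 τ]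
      fun t => (fderiv ℝ F (t, z)).comp (ContinuousLinearMap.inr ℝ ℝ ℂ) := by
    filter_upwards [hI.mem_nhds hτ] with t ht using fderiv_right_eq (x := (t, z)) (hd _ ⟨ht, hz⟩)
  have h6 := h2.clm_comp (hasDerivAt_const τ (ContinuousLinearMap.inr ℝ ℝ ℂ))
  refine (h6.congr_of_eventuallyEq h5).congr_deriv ?_
  rw [h4.fderiv_eq, (h3.clm_apply (hasFDerivAt_const ((1 : ℝ), (0 : ℂ)) z)).fderiv]
  ext1 u
  simp [hs.eq (1, 0) (0, u)]

end Parameter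

/-! ### Smooth families of functions and of forms -/

section Families

variable {S : Type*} {V : Type*} [NormedAddCommGroup V] [NormedSpace ℝ V] {ε : ℝ}

/-- The family of derivatives with respect to the parameter. -/
def derivFamily (f : ℝ → S → V) : ℝ → S → V := fun τ p => deriv (fun t => f t p) τ

theorem secondDeriv_eq (α : ℝ → OneForm S Mat) :
    secondDeriv α = derivFamily (derivFamily α) 0 := by
  funext p
  simp only [secondDeriv, derivFamily, iteratedDeriv_succ, iteratedDeriv_zero]

variable [TopologicalSpace S] [ChartedSpace ℂ S]

/-- A family of functions, smooth jointly in the parameter and the point. -/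
def SmoothFunFamily (ε : ℝ) (f : ℝ → S → V) : Prop :=
  ∀ p : S, ContDiffOn ℝ ∞ (fun x : ℝ × ℂ => f x.1 ((chartAt ℂ p).symm x.2))
    (Ioo (-ε) ε ×ˢ (chartAt ℂ p).target)

theorem contDiffOn_slice {F : ℝ × ℂ → V} {I : Set ℝ} {U : Set ℂ}
    (hF : ContDiffOn ℝ ∞ F (I ×ˢ U)) {τ : ℝ} (hτ : τ ∈ I) :
    ContDiffOn ℝ ∞ (fun z => F (τ, z)) U :=
  hF.comp (contDiff_const.prodMk contDiff_id).contDiffOn fun _ hz => ⟨hτ, hz⟩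

theorem SmoothFunFamily.deriv {f : ℝ → S → V} (hf : SmoothFunFamily ε f) :
    SmoothFunFamily ε (derivFamily f) := fun p =>
  contDiffOn_deriv_left isOpen_Ioo (chartAt ℂ p).open_target (hf p)

theorem SmoothFunFamily.smoothFun {f : ℝ → S → V} (hf : SmoothFunFamily ε f) {τ : ℝ}
    (hτ : τ ∈ Ioo (-ε) ε) : SmoothFun (f τ) := fun p => contDiffOn_slice (hf p) hτ

theorem SmoothFunFamily.contDiffOn_apply {f : ℝ → S → V} (hf : SmoothFunFamily ε f) (p : S) :
    ContDiffOn ℝ ∞ (fun t => f t p) (Ioo (-ε) ε) := by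
  have h := (hf p).comp (contDiff_id.prodMk (contDiff_const (c := chartAt ℂ p p))).contDiffOn
    fun t ht => ⟨ht, mem_chart_target ℂ p⟩
  refine h.congr fun t _ => ?_
  simp [(chartAt ℂ p).left_inv (mem_chart_source ℂ p)]

theorem hasDerivAt_of_contDiffOn {f : ℝ → V} (hf : ContDiffOn ℝ ∞ f (Ioo (-ε) ε)) {τ : ℝ}
    (hτ : τ ∈ Ioo (-ε) ε) : HasDerivAt f (deriv f τ) τ :=
  ((hf.contDiffAt (isOpen_Ioo.mem_nhds hτ)).differentiableAt (by simp)).hasDerivAt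

theorem SmoothFunFamily.hasDerivAt {f : ℝ → S → V} (hf : SmoothFunFamily ε f) (p : S) {τ : ℝ}
    (hτ : τ ∈ Ioo (-ε) ε) : HasDerivAt (fun t => f t p) (derivFamily f τ p) τ :=
  hasDerivAt_of_contDiffOn (hf.contDiffOn_apply p) hτ

theorem SmoothFormFamily.smoothForm {α : ℝ → OneForm S V} (hα : SmoothFormFamily ε α) {τ : ℝ}
    (hτ : τ ∈ Ioo (-ε) ε) : SmoothForm (α τ) := fun p => contDiffOn_slice (hα p) hτ

variable [IsManifold 𝓘(ℝ, ℂ) ∞ S]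

theorem SmoothFormFamily.contDiffOn_apply {α : ℝ → OneForm S V} (hα : SmoothFormFamily ε α)
    (p : S) : ContDiffOn ℝ ∞ (fun t => α t p) (Ioo (-ε) ε) := by
  have h := (hα p).comp (contDiff_id.prodMk (contDiff_const (c := chartAt ℂ p p))).contDiffOn
    fun t ht => ⟨ht, mem_chart_target ℂ p⟩
  exact h.congr fun t _ => (localRep_chartAt (α t) p).symm

theorem SmoothFormFamily.hasDerivAt {α : ℝ → OneForm S V} (hα : SmoothFormFamily ε α) (p : S)
    {τ : ℝ} (hτ : τ ∈ Ioo (-ε) ε) : HasDerivAt (fun t => α t p) (derivFamily α τ p) τ :=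
  hasDerivAt_of_contDiffOn (hα.contDiffOn_apply p) hτ

theorem SmoothFormFamily.localRep_deriv {α : ℝ → OneForm S V} (hα : SmoothFormFamily ε α)
    (e : OpenPartialHomeomorph S ℂ) {τ : ℝ} (hτ : τ ∈ Ioo (-ε) ε) (z : ℂ) :
    localRep e (derivFamily α τ) z = _root_.deriv (fun t => localRep e (α t) z) τ := by
  have h := ((hα.hasDerivAt (e.symm z) hτ).clm_comp (hasDerivAt_const τ (chartDiff e z))).deriv
  simp only [ContinuousLinearMap.comp_zero, add_zero] at h
  exact h.symm

theorem SmoothFormFamily.deriv {α : ℝ → OneForm S V} (hα : SmoothFormFamily ε α) :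
    SmoothFormFamily ε (derivFamily α) := fun p =>
  (contDiffOn_deriv_left isOpen_Ioo (chartAt ℂ p).open_target (hα p)).congr
    fun x hx => hα.localRep_deriv (chartAt ℂ p) hx.1 x.2

/-- The chart at p does not depend on the parameter, so this is the interchange of ∂/∂τ with the
derivative in the point. -/
theorem SmoothFormFamily.hasDerivAt_extDer {α : ℝ → OneForm S V} (hα : SmoothFormFamily ε α)
    {τ : ℝ} (hτ : τ ∈ Ioo (-ε) ε) (p : S) (u v : ℂ) :
    HasDerivAt (fun t => extDer (α t) p u v) (extDer (derivFamily α τ) p u v) τ := by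
  have h := hasDerivAt_fderiv_right isOpen_Ioo (chartAt ℂ p).open_target (hα p) hτ
    (mem_chart_target ℂ p)
  have hev : (fun w => _root_.deriv (fun t => localRep (chartAt ℂ p) (α t) w) τ)
      = localRep (chartAt ℂ p) (derivFamily α τ) :=
    funext fun w => (hα.localRep_deriv (chartAt ℂ p) hτ w).symm
  simp only [hev] at h
  have h2 : ∀ u v : ℂ, HasDerivAt
      (fun t => fderiv ℝ (localRep (chartAt ℂ p) (α t)) (chartAt ℂ p p) u v)
      (fderiv ℝ (localRep (chartAt ℂ p) (derivFamily α τ)) (chartAt ℂ p p) u v) τ := fun u v => by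
    simpa using (h.clm_apply (hasDerivAt_const τ u)).clm_apply (hasDerivAt_const τ v)
  exact (h2 u v).sub (h2 v u)

theorem SmoothFunFamily.contDiffOn_differential {f : ℝ → S → Mat} (hf : SmoothFunFamily ε f)
    (p : S) : ContDiffOn ℝ ∞ (fun t => differential (f t) p) (Ioo (-ε) ε) :=
  (contDiffOn_fderiv_right isOpen_Ioo (chartAt ℂ p).open_target (hf p)
    (mem_chart_target ℂ p)).congr fun _ ht => differential_eq (hf.smoothFun ht) p

theorem SmoothFunFamily.hasDerivAt_differential {f : ℝ → S → Mat} (hf : SmoothFunFamily ε f)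
    {τ : ℝ} (hτ : τ ∈ Ioo (-ε) ε) (p : S) :
    HasDerivAt (fun t => differential (f t) p) (differential (derivFamily f τ) p) τ := by
  have h := hasDerivAt_fderiv_right isOpen_Ioo (chartAt ℂ p).open_target (hf p) hτ
    (mem_chart_target ℂ p)
  rw [differential_eq (hf.deriv.smoothFun hτ)]
  refine h.congr_of_eventuallyEq ?_
  filter_upwards [isOpen_Ioo.mem_nhds hτ] with t ht using differential_eq (hf.smoothFun ht) p

end Families

/-! ### Change of gauge -/

section Gauge

theorem hasDerivAt_eq_of_eqOn {V : Type*} [NormedAddCommGroup V] [NormedSpace ℝ V] {ε : ℝ}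
    {f g : ℝ → V} {f' g' : V} {τ : ℝ} (h : ∀ t ∈ Ioo (-ε) ε, f t = g t) (hτ : τ ∈ Ioo (-ε) ε)
    (hf : HasDerivAt f f' τ) (hg : HasDerivAt g g' τ) : f' = g' := by
  refine hf.unique (hg.congr_of_eventuallyEq ?_)
  filter_upwards [isOpen_Ioo.mem_nhds hτ] with t ht using h t ht

theorem hasDerivAt_clm_apply {f : ℝ → ℂ →L[ℝ] Mat} {f' : ℂ →L[ℝ] Mat} {t : ℝ}
    (h : HasDerivAt f f' t) (v : ℂ) : HasDerivAt (fun t => f t v) (f' v) t := by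
  simpa using h.clm_apply (hasDerivAt_const t v)

/-- Here d stands for dg(0), b for A'(0), y for dξ and x for D'. The factor 0 is A(0), kept so that
the hypothesis matches the differentiated identity. The terms ξ d cancel. -/
theorem first_order_gauge {g ξ d x b y : Mat} (hg : g.det = 1)
    (h : ξ * g * (g⁻¹ * d) + g * x = b * g + 0 * (ξ * g) + (ξ * d + y * g)) :
    x = g⁻¹ * ((b + y) * g) := by
  have hc : ∀ w : Mat, g * (g⁻¹ * w) = w := fun w => by
    rw [← mul_assoc, mul_inv_self hg, one_mul]
  rw [zero_mul, add_zero, mul_assoc, hc, add_left_comm] at h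
  rw [add_mul, ← add_left_cancel h, ← mul_assoc, inv_mul_self hg, one_mul]

/-- Second-order analogue: b₂ is A''(0), y is dη, x is D'', and e is the first derivative before
conjugation. The terms η d cancel. -/
theorem second_order_gauge {g ξ η d x e b b₂ y : Mat} (hg : g.det = 1)
    (h : η * g * (g⁻¹ * d) + 2 * (ξ * g * (g⁻¹ * (e * g))) + g * x
      = b₂ * g + 2 * (b * (ξ * g)) + 0 * (η * g) + (η * d + y * g)) :
    x = g⁻¹ * ((b₂ + b * ((2 : ℝ) • ξ) + (-2 : ℝ) • ξ * e + y) * g) := by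
  have hc : ∀ w : Mat, g * (g⁻¹ * w) = w := fun w => by
    rw [← mul_assoc, mul_inv_self hg, one_mul]
  have h1 : g * x = (b₂ + b * ((2 : ℝ) • ξ) + (-2 : ℝ) • ξ * e + y) * g := by
    simp only [zero_mul, add_zero, mul_assoc, hc, two_mul] at h
    simp only [Algebra.mul_smul_comm, Algebra.smul_mul_assoc, add_mul, mul_assoc]
    rw [← sub_eq_zero] at h ⊢
    rw [← h]
    module
  rw [← h1, ← mul_assoc, inv_mul_self hg, one_mul]

/-- First and second order consequences of an identity `a x = b a + c`. -/
theorem mul_eq_deriv_identities {ε : ℝ} (hε : 0 < ε) {a a₁ x x₁ b b₁ c c₁ : ℝ → Mat}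
    {a₂ x₂ b₂ c₂ : Mat} (h : ∀ t ∈ Ioo (-ε) ε, a t * x t = b t * a t + c t)
    (ha : ∀ t ∈ Ioo (-ε) ε, HasDerivAt a (a₁ t) t) (ha₁ : HasDerivAt a₁ a₂ 0)
    (hx : ∀ t ∈ Ioo (-ε) ε, HasDerivAt x (x₁ t) t) (hx₁ : HasDerivAt x₁ x₂ 0)
    (hb : ∀ t ∈ Ioo (-ε) ε, HasDerivAt b (b₁ t) t) (hb₁ : HasDerivAt b₁ b₂ 0)
    (hc : ∀ t ∈ Ioo (-ε) ε, HasDerivAt c (c₁ t) t) (hc₁ : HasDerivAt c₁ c₂ 0) :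
    a₁ 0 * x 0 + a 0 * x₁ 0 = b₁ 0 * a 0 + b 0 * a₁ 0 + c₁ 0 ∧
    a₂ * x 0 + 2 * (a₁ 0 * x₁ 0) + a 0 * x₂ = b₂ * a 0 + 2 * (b₁ 0 * a₁ 0) + b 0 * a₂ + c₂ := by
  have h0 : (0 : ℝ) ∈ Ioo (-ε) ε := ⟨by linarith, hε⟩
  have h1 : ∀ t ∈ Ioo (-ε) ε, a₁ t * x t + a t * x₁ t = b₁ t * a t + b t * a₁ t + c₁ t :=
    fun t ht => hasDerivAt_eq_of_eqOn h ht ((ha t ht).mul (hx t ht))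
      (((hb t ht).mul (ha t ht)).add (hc t ht))
  refine ⟨h1 0 h0, ?_⟩
  have h2 := hasDerivAt_eq_of_eqOn h1 h0
    ((ha₁.mul (hx 0 h0)).add ((ha 0 h0).mul hx₁))
    (((hb₁.mul (ha 0 h0)).add ((hb 0 h0).mul ha₁)).add hc₁)
  calc _ = a₂ * x 0 + a₁ 0 * x₁ 0 + (a₁ 0 * x₁ 0 + a 0 * x₂) := by rw [two_mul]; abel
    _ = _ := h2
    _ = _ := by rw [two_mul]; abel

variable {S : Type*}

/-- Cyclicity of the trace; this removes g(0) from the integrand. -/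
theorem trace_wedge_adForm {g : S → Mat} (hdet : ∀ p, (g p).det = 1) (α β : OneForm S Mat) (p : S)
    (u v : ℂ) : (wedge (adForm g α) (adForm g β) p u v).trace = (wedge α β p u v).trace := by
  have h : ∀ w : Mat, g p * ((g p)⁻¹ * w) = w := fun w => by
    rw [← mul_assoc, mul_inv_self (hdet p), one_mul]
  simp only [wedge, adForm, lmulForm_apply, rmulForm_apply, Matrix.trace_sub, mul_assoc, h]
  rw [Matrix.trace_mul_comm, Matrix.trace_mul_comm (g p)⁻¹ (α p v * (β p u * g p))]
  simp only [mul_assoc, mul_inv_self (hdet p), mul_one]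

theorem hodgeStar_adForm (g : S → Mat) (α : OneForm S Mat) :
    hodgeStar (adForm g α) = adForm g (hodgeStar α) := by
  funext p
  ext1 v
  simp [hodgeStar, adForm]

variable [TopologicalSpace S] [ChartedSpace ℂ S]

/-- The first derivative, up to conjugation, of a family with first derivative `α` in a gauge with
logarithmic derivative `ξ`. -/
def gaugedFirst (α : OneForm S Mat) (ξ : S → Mat) : OneForm S Mat := α + differential ξ

/-- The second derivative, up to conjugation, of a family with derivatives `α` and `β` in a gauge
with normalized derivatives `ξ` and `η`. -/
def gaugedSecond (α β : OneForm S Mat) (ξ η : S → Mat) : OneForm S Mat :=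
  β + rmulForm α ((2 : ℝ) • ξ) + lmulForm ((-2 : ℝ) • ξ) (gaugedFirst α ξ) + differential η

theorem gaugeAct_apply (A : OneForm S Mat) (g : S → Mat) (p : S) (v : ℂ) :
    gaugeAct A g p v = (g p)⁻¹ * A p v * g p + (g p)⁻¹ * differential g p v := rfl

theorem gaugeAct_zero (g : S → Mat) :
    gaugeAct 0 g = lmulForm (fun p => (g p)⁻¹) (differential g) := by
  funext p
  ext1 v
  simp [gaugeAct_apply]

theorem StructureGroup.det_eq_one {G : StructureGroup} {a : Mat} (h : a ∈ G.carrier) :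
    a.det = 1 := by
  cases G with
  | SU2 => exact (Matrix.mem_specialUnitaryGroup_iff.1 h).2
  | SL2C => exact h

theorem StructureGroup.mul_mem {G : StructureGroup} {a b : Mat} (ha : a ∈ G.carrier)
    (hb : b ∈ G.carrier) : a * b ∈ G.carrier := by
  cases G with
  | SU2 => exact (Matrix.specialUnitaryGroup (Fin 2) ℂ).mul_mem ha hb
  | SL2C =>
    change (a * b).det = 1
    rw [Matrix.det_mul, show a.det = 1 from ha, show b.det = 1 from hb, one_mul]

theorem IsGaugeFamily.mul {G : StructureGroup} {ε : ℝ} {h k : ℝ → S → Mat}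
    (hh : IsGaugeFamily G ε h) (hk : IsGaugeFamily G ε k) : IsGaugeFamily G ε (h * k) where
  smooth := (contDiff_mul (𝕜 := ℝ) (𝔸 := Mat) (n := ∞)).contMDiff.comp_contMDiffOn
    (hh.smooth.prodMk_space hk.smooth)
  mem_group τ hτ p := StructureGroup.mul_mem (hh.mem_group τ hτ p) (hk.mem_group τ hτ p)

variable [IsManifold 𝓘(ℝ, ℂ) ∞ S]

theorem gaugeAct_gaugeAct (A : OneForm S Mat) {h k : S → Mat} (hh : SmoothFun h)
    (hk : SmoothFun k) (hdet : ∀ p, (h p).det = 1) :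
    gaugeAct (gaugeAct A h) k = gaugeAct A (h * k) := by
  funext p
  ext1 v
  have h1 : ∀ w : Mat, (h p)⁻¹ * (h p * w) = w := fun w => by
    rw [← mul_assoc, inv_mul_self (hdet p), one_mul]
  simp only [gaugeAct_apply, differential_mul hh hk, Pi.add_apply, _root_.add_apply,
    lmulForm_apply, rmulForm_apply, Pi.mul_apply, Matrix.mul_inv_rev, mul_assoc, mul_add, add_mul,
    h1]
  abel

theorem IsGaugeFamily.smoothFunFamily {G : StructureGroup} {ε : ℝ} {g : ℝ → S → Mat}
    (hg : IsGaugeFamily G ε g) : SmoothFunFamily ε g := by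
  intro p
  have h1 : ContMDiffOn 𝓘(ℝ, ℝ × ℂ) 𝓘(ℝ, ℂ) ∞ (fun x : ℝ × ℂ => (chartAt ℂ p).symm x.2)
      (Ioo (-ε) ε ×ˢ (chartAt ℂ p).target) :=
    (contMDiffOn_symm_of_mem_maximalAtlas (I := 𝓘(ℝ, ℂ)) (n := ∞)
      (IsManifold.chart_mem_maximalAtlas (I := 𝓘(ℝ, ℂ)) (n := ∞) p)).comp
      (contDiff_snd.contMDiff.contMDiffOn) fun x hx => hx.2
  have h2 : ContMDiffOn 𝓘(ℝ, ℝ × ℂ) 𝓘(ℝ, ℝ) ∞ (fun x : ℝ × ℂ => x.1)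
      (Ioo (-ε) ε ×ˢ (chartAt ℂ p).target) := contDiff_fst.contMDiff.contMDiffOn
  exact contMDiffOn_iff_contDiffOn.1 (hg.smooth.comp (h2.prodMk h1) fun x hx => ⟨hx.1, mem_univ _⟩)

theorem gauged_eq_gauged_mul {G : StructureGroup} {ε : ℝ} {A B : ℝ → OneForm S Mat}
    {h k : ℝ → S → Mat}
    (hh : IsGaugeFamily G ε h) (hk : IsGaugeFamily G ε k)
    (hB : ∀ τ ∈ Ioo (-ε) ε, B τ = gaugeAct (A τ) (h τ)) {τ : ℝ} (hτ : τ ∈ Ioo (-ε) ε) :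
    gauged B k τ = gauged A (h * k) τ := by
  rw [gauged, hB τ hτ, gaugeAct_gaugeAct _ (hh.smoothFunFamily.smoothFun hτ)
    (hk.smoothFunFamily.smoothFun hτ)
    fun p => StructureGroup.det_eq_one (hh.mem_group τ hτ p)]
  rfl

theorem SmoothForm.gaugedFirst {α : OneForm S Mat} {ξ : S → Mat} (hα : SmoothForm α)
    (hξ : SmoothFun ξ) : SmoothForm (gaugedFirst α ξ) :=
  hα.add hξ.smoothForm_differential

theorem SmoothForm.gaugedSecond {α β : OneForm S Mat} {ξ η : S → Mat} (hα : SmoothForm α)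
    (hβ : SmoothForm β) (hξ : SmoothFun ξ) (hη : SmoothFun η) :
    SmoothForm (gaugedSecond α β ξ η) :=
  ((hβ.add (hα.rmul (hξ.const_smul 2))).add ((hα.gaugedFirst hξ).lmul (hξ.const_smul (-2)))).add
    hη.smoothForm_differential

theorem contDiffOn_gauged_apply {G : StructureGroup} {ε : ℝ} {A : ℝ → OneForm S Mat}
    (hA : SmoothFormFamily ε A) {g : ℝ → S → Mat} (hg : IsGaugeFamily G ε g) (p : S) :
    ContDiffOn ℝ ∞ (fun t => gauged A g t p) (Ioo (-ε) ε) := by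
  have ha := hg.smoothFunFamily.contDiffOn_apply p
  have hai : ContDiffOn ℝ ∞ (fun t => (g t p)⁻¹) (Ioo (-ε) ε) := fun t ht =>
    ContDiffAt.comp_contDiffWithinAt (f := fun t => g t p) t
      (contDiffAt_matrix_inv (StructureGroup.det_eq_one (hg.mem_group t ht p))) (ha t ht)
  refine contDiffOn_clm_apply.2 fun v => ?_
  have hb : ContDiffOn ℝ ∞ (fun t => A t p v) (Ioo (-ε) ε) :=
    (hA.contDiffOn_apply p).clm_apply contDiffOn_const
  have hc : ContDiffOn ℝ ∞ (fun t => differential (g t) p v) (Ioo (-ε) ε) :=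
    (hg.smoothFunFamily.contDiffOn_differential p).clm_apply contDiffOn_const
  exact (((hai.mul hb).mul ha).add (hai.mul hc)).congr fun t _ => gaugeAct_apply _ _ _ _

/-- The derivatives of the identity `g D = A g + dg`. -/
theorem gauged_deriv_identities {G : StructureGroup} {ε : ℝ} (hε : 0 < ε)
    {A : ℝ → OneForm S Mat} (hA : SmoothFormFamily ε A) {g : ℝ → S → Mat}
    (hg : IsGaugeFamily G ε g) (p : S) (v : ℂ) :
    derivFamily g 0 p * gauged A g 0 p v + g 0 p * derivFamily (gauged A g) 0 p v
      = derivFamily A 0 p v * g 0 p + A 0 p v * derivFamily g 0 p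
        + differential (derivFamily g 0) p v ∧
    derivFamily (derivFamily g) 0 p * gauged A g 0 p v
        + 2 * (derivFamily g 0 p * derivFamily (gauged A g) 0 p v)
        + g 0 p * derivFamily (derivFamily (gauged A g)) 0 p v
      = derivFamily (derivFamily A) 0 p v * g 0 p
        + 2 * (derivFamily A 0 p v * derivFamily g 0 p)
        + A 0 p v * derivFamily (derivFamily g) 0 p
        + differential (derivFamily (derivFamily g) 0) p v := by
  have h0 : (0 : ℝ) ∈ Ioo (-ε) ε := ⟨by linarith, hε⟩
  have hgs := hg.smoothFunFamily
  have hX := contDiffOn_gauged_apply hA hg p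
  have hX1 : ∀ t ∈ Ioo (-ε) ε, HasDerivAt (fun t => gauged A g t p)
      (derivFamily (gauged A g) t p) t := fun t ht => hasDerivAt_of_contDiffOn hX ht
  have hX2 : HasDerivAt (fun t => derivFamily (gauged A g) t p)
      (derivFamily (derivFamily (gauged A g)) 0 p) 0 :=
    hasDerivAt_of_contDiffOn (hX.deriv_of_isOpen (m := ∞) isOpen_Ioo (by simp)) h0
  exact mul_eq_deriv_identities hε
    (a := fun t => g t p) (a₁ := fun t => derivFamily g t p)
    (x := fun t => gauged A g t p v) (x₁ := fun t => derivFamily (gauged A g) t p v)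
    (b := fun t => A t p v) (b₁ := fun t => derivFamily A t p v)
    (c := fun t => differential (g t) p v) (c₁ := fun t => differential (derivFamily g t) p v)
    -- Multiplying the gauge formula by g on the left clears the inverses, so no derivative of g⁻¹
    -- is ever needed.
    (fun t ht => by
      have h : ∀ w : Mat, g t p * ((g t p)⁻¹ * w) = w := fun w => by
        rw [← mul_assoc, mul_inv_self (StructureGroup.det_eq_one (hg.mem_group t ht p)), one_mul]
      simp only [gauged, gaugeAct_apply, mul_add, mul_assoc, h])
    (fun t ht => hgs.hasDerivAt p ht) (hgs.deriv.hasDerivAt p h0)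
    (fun t ht => hasDerivAt_clm_apply (hX1 t ht) v) (hasDerivAt_clm_apply hX2 v)
    (fun t ht => hasDerivAt_clm_apply (hA.hasDerivAt p ht) v)
    (hasDerivAt_clm_apply (hA.deriv.hasDerivAt p h0) v)
    (fun t ht => hasDerivAt_clm_apply (hgs.hasDerivAt_differential ht p) v)
    (hasDerivAt_clm_apply (hgs.deriv.hasDerivAt_differential h0 p) v)

/-- The derivatives of a gauged family. -/
theorem exists_gauged_derivatives {G : StructureGroup} {ε : ℝ} (hε : 0 < ε)
    {A : ℝ → OneForm S Mat} (hA : IsFlatFamily G ε A) {g : ℝ → S → Mat}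
    (hg : IsGaugeFamily G ε g) :
    ∃ ξ η : S → Mat, SmoothFun ξ ∧ SmoothFun η ∧
      firstDeriv (gauged A g) = adForm (g 0) (gaugedFirst (firstDeriv A) ξ) ∧
      secondDeriv (gauged A g) =
        adForm (g 0) (gaugedSecond (firstDeriv A) (secondDeriv A) ξ η) := by
  have h0 : (0 : ℝ) ∈ Ioo (-ε) ε := ⟨by linarith, hε⟩
  have hgs := hg.smoothFunFamily
  have hdet : ∀ p, (g 0 p).det = 1 := fun p => StructureGroup.det_eq_one (hg.mem_group 0 h0 p)
  have hg0 := hgs.smoothFun h0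
  -- Each τ-derivative γ of g at 0 is written as ξ g(0) with ξ = γ g(0)⁻¹, which makes g(0) enter
  -- only by conjugation.
  have hfactor : ∀ γ : S → Mat, SmoothFun γ → ∃ ξ : S → Mat, SmoothFun ξ ∧
      (∀ p, γ p = ξ p * g 0 p) ∧ ∀ p v, differential γ p v
        = ξ p * differential (g 0) p v + differential ξ p v * g 0 p := by
    intro γ hγ
    have hξ := hγ.mul (hg0.inv hdet)
    have hc : γ * (fun p => (g 0 p)⁻¹) * g 0 = γ := by
      funext p
      simp [mul_assoc, inv_mul_self (hdet p)]
    have hd := differential_mul hξ hg0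
    rw [hc] at hd
    exact ⟨_, hξ, fun p => (congrFun hc p).symm, fun p v => by rw [hd]; rfl⟩
  obtain ⟨ξ, hξ, hγξ, hdξ⟩ := hfactor _ (hgs.deriv.smoothFun h0)
  obtain ⟨η, hη, hγη, hdη⟩ := hfactor _ (hgs.deriv.deriv.smoothFun h0)
  have hA0 : ∀ p v, A 0 p v = 0 := fun p v => by rw [hA.at_zero]; rfl
  have hX0 : ∀ p v, gauged A g 0 p v = (g 0 p)⁻¹ * differential (g 0) p v := fun p v => by
    simp [gauged, gaugeAct_apply, hA0]
  have hfirst : ∀ p v, derivFamily (gauged A g) 0 p v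
      = (g 0 p)⁻¹ * (gaugedFirst (firstDeriv A) ξ p v * g 0 p) := fun p v => by
    have h1 := (gauged_deriv_identities hε hA.smooth hg p v).1
    rw [hX0, hγξ, hdξ, hA0] at h1
    exact first_order_gauge (hdet p) h1
  refine ⟨ξ, η, hξ, hη, ?_, ?_⟩
  · funext p
    ext1 v
    exact hfirst p v
  · rw [secondDeriv_eq, secondDeriv_eq]
    funext p
    ext1 v
    have h1 := (gauged_deriv_identities hε hA.smooth hg p v).2
    rw [hX0, hγξ, hγη, hdη, hA0, hfirst] at h1
    exact second_order_gauge (hdet p) h1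

/-- The derivatives of the flatness equation. -/
theorem IsFlatFamily.extDer_derivatives {G : StructureGroup} {ε : ℝ} (hε : 0 < ε)
    {A : ℝ → OneForm S Mat} (hA : IsFlatFamily G ε A) (p : S) (u v : ℂ) :
    extDer (firstDeriv A) p u v = 0 ∧
    extDer (secondDeriv A) p u v = -(2 * wedge (firstDeriv A) (firstDeriv A) p u v) := by
  have h0 : (0 : ℝ) ∈ Ioo (-ε) ε := ⟨by linarith, hε⟩
  have hA0 : ∀ p v, A 0 p v = 0 := fun p v => by rw [hA.at_zero]; rfl
  have ha : ∀ w : ℂ, ∀ t ∈ Ioo (-ε) ε, HasDerivAt (fun t => A t p w) (derivFamily A t p w) t :=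
    fun w t ht => hasDerivAt_clm_apply (hA.smooth.hasDerivAt p ht) w
  have ha₁ : ∀ w : ℂ, HasDerivAt (fun t => derivFamily A t p w)
      (derivFamily (derivFamily A) 0 p w) 0 :=
    fun w => hasDerivAt_clm_apply (hA.smooth.deriv.hasDerivAt p h0) w
  have hflat : ∀ t ∈ Ioo (-ε) ε,
      extDer (A t) p u v + (A t p u * A t p v - A t p v * A t p u) = 0 := fun t ht =>
    congrFun (congrFun (congrFun (hA.flat t ht) p) u) v
  have h1 : ∀ t ∈ Ioo (-ε) ε, extDer (derivFamily A t) p u v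
      + (derivFamily A t p u * A t p v + A t p u * derivFamily A t p v
        - (derivFamily A t p v * A t p u + A t p v * derivFamily A t p u)) = 0 := fun t ht =>
    hasDerivAt_eq_of_eqOn hflat ht
      ((hA.smooth.hasDerivAt_extDer ht p u v).add
        (((ha u t ht).mul (ha v t ht)).sub ((ha v t ht).mul (ha u t ht)))) (hasDerivAt_const t 0)
  have h2 := hasDerivAt_eq_of_eqOn h1 h0
      ((hA.smooth.deriv.hasDerivAt_extDer h0 p u v).add
        ((((ha₁ u).mul (ha v 0 h0)).add ((ha u 0 h0).mul (ha₁ v))).sub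
          (((ha₁ v).mul (ha u 0 h0)).add ((ha v 0 h0).mul (ha₁ u))))) (hasDerivAt_const 0 0)
  have h3 := h1 0 h0
  -- Since A(0) = 0, only products of two first derivatives survive; each occurs twice, hence the
  -- factor 2.
  simp only [hA0, mul_zero, zero_mul, add_zero, zero_add, sub_zero] at h2 h3
  refine ⟨h3, ?_⟩
  rw [secondDeriv_eq]
  refine (eq_neg_of_add_eq_zero_left h2).trans ?_
  rw [neg_inj, two_mul]
  change _ = (derivFamily A 0 p u * derivFamily A 0 p v - derivFamily A 0 p v * derivFamily A 0 p u)
    + (derivFamily A 0 p u * derivFamily A 0 p v - derivFamily A 0 p v * derivFamily A 0 p u)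
  abel

/-- Pointwise algebra behind exactness: a, x, n are the values of α, dξ₁, d(η₂ − η₁) on one vector,
the primed letters those on another. The left side is the change of the trace form, the right side
the expanded dθ. They agree up to four commutators, which have zero trace. -/
theorem trace_gauge_change_identity (a a' x x' n n' c : Mat) :
    ((a + x) * ((2 : ℝ) • (a' * c) - (2 : ℝ) • (c * (a' + x')) + n')
      - (a' + x') * ((2 : ℝ) • (a * c) - (2 : ℝ) • (c * (a + x)) + n)).trace
    = (-((a + x) * ((2 : ℝ) • (x' * c) - n') - (a' + x') * ((2 : ℝ) • (x * c) - n))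
      + (4 : ℝ) • ((a * a' - a' * a) * c)
      + (4 : ℝ) • (x * ((a' + x') * c) - x' * ((a + x) * c))
      + (4 : ℝ) • (a * (x' * c) - a' * (x * c))).trace := by
  have h : ((a + x) * ((2 : ℝ) • (a' * c) - (2 : ℝ) • (c * (a' + x')) + n')
      - (a' + x') * ((2 : ℝ) • (a * c) - (2 : ℝ) • (c * (a + x)) + n))
    = (-((a + x) * ((2 : ℝ) • (x' * c) - n') - (a' + x') * ((2 : ℝ) • (x * c) - n))
      + (4 : ℝ) • ((a * a' - a' * a) * c)
      + (4 : ℝ) • (x * ((a' + x') * c) - x' * ((a + x) * c))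
      + (4 : ℝ) • (a * (x' * c) - a' * (x * c)))
      + (2 : ℝ) • ((a' + x') * (c * (a + x)) - (c * (a + x)) * (a' + x'))
      - (2 : ℝ) • ((a + x) * (c * (a' + x')) - (c * (a' + x')) * (a + x))
      + (2 : ℝ) • (c * ((a + x) * (a' + x')) - ((a + x) * (a' + x')) * c)
      - (2 : ℝ) • (c * ((a' + x') * (a + x)) - ((a' + x') * (a + x)) * c) := by
    simp only [mul_add, add_mul, mul_sub, sub_mul, mul_assoc, Algebra.mul_smul_comm, smul_sub,
      smul_add]
    module
  have hc : ∀ y w : Mat, (y * w - w * y).trace = 0 := fun y w => by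
    rw [Matrix.trace_sub, Matrix.trace_mul_comm, sub_self]
  rw [h]
  simp only [Matrix.trace_add _ _, Matrix.trace_sub _ (_ • _), Matrix.trace_smul, hc, smul_zero,
    add_zero, sub_zero]

/-- A change of harmonic gauge changes the trace form by an exact form. -/
theorem exists_trace_wedge_eq_add_extDer {α β : OneForm S Mat} (hα : SmoothForm α)
    (hβ : SmoothForm β) (hdα : ∀ p u v, extDer α p u v = 0)
    (hdβ : ∀ p u v, extDer β p u v = -(2 * wedge α α p u v)) {ξ₁ ξ₂ η₁ η₂ : S → Mat}
    (hξ₁ : SmoothFun ξ₁) (hξ₂ : SmoothFun ξ₂) (hη₁ : SmoothFun η₁) (hη₂ : SmoothFun η₂)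
    (hξ : differential (ξ₂ - ξ₁) = 0) :
    ∃ θ : OneForm S ℂ, SmoothForm θ ∧ ∀ p u v,
      (wedge (gaugedFirst α ξ₂) (gaugedSecond α β ξ₂ η₂) p u v).trace
        = (wedge (gaugedFirst α ξ₁) (gaugedSecond α β ξ₁ η₁) p u v).trace + extDer θ p u v := by
  set c := ξ₂ - ξ₁ with hcdef
  have hc : SmoothFun c := hξ₂.sub hξ₁
  have hη : SmoothFun (η₂ - η₁) := hη₂.sub hη₁
  have hξc := hξ₁.mul hc
  have hE := hα.gaugedFirst hξ₁
  have hF := (hξc.const_smul 2).sub hη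
  have hdE : ∀ p u v, extDer (gaugedFirst α ξ₁) p u v = 0 := fun p u v => by
    rw [gaugedFirst, extDer_add hα hξ₁.smoothForm_differential, extDer_differential hξ₁]
    simp [hdα]
  have hdξ : differential ξ₂ = differential ξ₁ := by
    rw [hcdef, differential_sub hξ₂ hξ₁] at hξ
    exact sub_eq_zero.1 hξ
  have hdξc : ∀ p v, differential (ξ₁ * c) p v = differential ξ₁ p v * c p := fun p v => by
    rw [differential_mul hξ₁ hc, hξ]; simp
  have hdF : ∀ p v, differential ((2 : ℝ) • (ξ₁ * c) - (η₂ - η₁)) p v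
      = (2 : ℝ) • (differential ξ₁ p v * c p) - (differential η₂ p v - differential η₁ p v) :=
    fun p v => by
    rw [differential_sub (hξc.const_smul 2) hη, differential_const_smul hξc,
      differential_sub hη₂ hη₁, ← hdξc]
    rfl
  have hs1 := hE.rmul hF
  have hs2 := hβ.rmul (hc.const_smul (-2))
  have hs3 := (hE.rmul hc).lmul (hξ₁.const_smul 4)
  have hs4 := hα.rmul (hξc.const_smul (-4))
  -- With E = α + dξ₁, θ = tr(E(2ξ₁c − (η₂ − η₁)) − 2βc + 4ξ₁Ec − 4αξ₁c). The first summand yields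
  -- −2E∧dξ₁ c + E∧d(η₂ − η₁); the other three yield 4α∧α c, 4dξ₁∧E c and 4α∧dξ₁ c, which add up to
  -- 4E∧E c.
  refine ⟨mapForm traceCLM (rmulForm (gaugedFirst α ξ₁) ((2 : ℝ) • (ξ₁ * c) - (η₂ - η₁))
    + rmulForm β ((-2 : ℝ) • c) + lmulForm ((4 : ℝ) • ξ₁) (rmulForm (gaugedFirst α ξ₁) c)
    + rmulForm α ((-4 : ℝ) • (ξ₁ * c))), (((hs1.add hs2).add hs3).add hs4).map _, fun p u v => ?_⟩
  rw [extDer_mapForm (((hs1.add hs2).add hs3).add hs4), extDer_add ((hs1.add hs2).add hs3) hs4,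
    extDer_add (hs1.add hs2) hs3, extDer_add hs1 hs2, traceCLM_apply, ← sub_eq_iff_eq_add',
    ← Matrix.trace_sub]
  simp only [Pi.add_apply]
  rw [extDer_rmulForm hF hE, extDer_rmulForm (hc.const_smul (-2)) hβ,
    extDer_lmulForm (hξ₁.const_smul 4) (hE.rmul hc), extDer_rmulForm hc hE,
    extDer_rmulForm (hξc.const_smul (-4)) hα, hdE, hdα, hdβ,
    differential_const_smul hc, differential_const_smul hξ₁, differential_const_smul hξc, hξ]
  have hcp : ξ₂ p = ξ₁ p + c p := by simp [hcdef]
  refine Eq.trans ?_ ((trace_gauge_change_identity (α p u) (α p v) (differential ξ₁ p u)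
    (differential ξ₁ p v) (differential η₂ p u - differential η₁ p u)
    (differential η₂ p v - differential η₁ p v) (c p)).trans ?_)
  · congr 1
    simp only [wedge, gaugedFirst, gaugedSecond, Pi.add_apply, _root_.add_apply, lmulForm_apply,
      rmulForm_apply, Pi.smul_apply, hdξ, hcp]
    simp only [mul_add, add_mul, mul_sub, Algebra.mul_smul_comm, Algebra.smul_mul_assoc, smul_add,
      neg_smul, neg_mul, mul_neg]
    abel
  · congr 1
    simp only [wedge, hdF, hdξc, gaugedFirst, Pi.add_apply, _root_.add_apply, rmulForm_apply,
      Pi.smul_apply, _root_.smul_apply, Pi.zero_apply, _root_.zero_apply, smul_zero, mul_zero,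
      zero_mul, sub_zero, zero_sub, add_zero, two_mul]
    simp only [mul_add, add_mul, mul_sub, sub_mul, mul_assoc, Algebra.mul_smul_comm,
      Algebra.smul_mul_assoc, smul_sub, smul_add, neg_mul]
    module

end Gauge

/-! ### Independence of the harmonic gauge -/

section Main

variable {S : Type*} [TopologicalSpace S] [T2Space S] [CompactSpace S] [ChartedSpace ℂ S]
  [IsManifold 𝓘(ℂ, ℂ) ω S] {G : StructureGroup} {ε : ℝ} {A : ℝ → OneForm S Mat}

/-- Undoing the conjugation by g(0) replaces D(0) by d, so any harmonic gauge is described by ξ and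
η alone, whatever g(0) is. Only co-closedness is recorded, because α + dξ is closed already by
flatness. -/
theorem IsHarmonicGauge.exists_normal_form [IsManifold 𝓘(ℝ, ℂ) ∞ S] (hε : 0 < ε)
    (hA : IsFlatFamily G ε A) {g : ℝ → S → Mat} (hg : IsHarmonicGauge G ε A g) :
    ∃ ξ η : S → Mat, SmoothFun ξ ∧ SmoothFun η ∧
      extDer (hodgeStar (gaugedFirst (firstDeriv A) ξ)) = 0 ∧
      curvatureK A g = Complex.I / (2 * Real.pi) * surfaceIntegral (fun (p : S) u v =>
        (wedge (gaugedFirst (firstDeriv A) ξ)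
          (gaugedSecond (firstDeriv A) (secondDeriv A) ξ η) p u v).trace) := by
  have h0 : (0 : ℝ) ∈ Ioo (-ε) ε := ⟨by linarith, hε⟩
  obtain ⟨ξ, η, hξ, hη, h1, h2⟩ := exists_gauged_derivatives hε hA hg.gauge
  have hdet : ∀ p, (g 0 p).det = 1 := fun p =>
    StructureGroup.det_eq_one (hg.gauge.mem_group 0 h0 p)
  refine ⟨ξ, η, hξ, hη, ?_, ?_⟩
  · have h := hg.harmonic.2
    rw [h1, hodgeStar_adForm, gauged, hA.at_zero, gaugeAct_zero] at h
    exact extDer_eq_zero_of_covExtDer_adForm (hg.gauge.smoothFunFamily.smoothFun h0) hdet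
      ((hA.smooth.deriv.smoothForm h0).gaugedFirst hξ).hodgeStar h
  · rw [curvatureK, h1, h2]
    simp only [trace_wedge_adForm hdet]

theorem curvatureK_eq_of_harmonicGauge (hε : 0 < ε) (hA : IsFlatFamily G ε A)
    {g₁ g₂ : ℝ → S → Mat} (h₁ : IsHarmonicGauge G ε A g₁) (h₂ : IsHarmonicGauge G ε A g₂) :
    curvatureK A g₁ = curvatureK A g₂ := by
  have := isManifold_real S
  have h0 : (0 : ℝ) ∈ Ioo (-ε) ε := ⟨by linarith, hε⟩
  obtain ⟨ξ₁, η₁, hξ₁, hη₁, hs₁, hK₁⟩ := h₁.exists_normal_form hε hA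
  obtain ⟨ξ₂, η₂, hξ₂, hη₂, hs₂, hK₂⟩ := h₂.exists_normal_form hε hA
  have hα : SmoothForm (firstDeriv A) := hA.smooth.deriv.smoothForm h0
  have hβ : SmoothForm (secondDeriv A) := by
    rw [secondDeriv_eq]; exact hA.smooth.deriv.deriv.smoothForm h0
  have hstar : hodgeStar (gaugedFirst (firstDeriv A) ξ₂)
      = hodgeStar (gaugedFirst (firstDeriv A) ξ₁) + hodgeStar (differential (ξ₂ - ξ₁)) := by
    rw [differential_sub hξ₂ hξ₁]
    funext p
    ext1 v
    simp [hodgeStar, gaugedFirst]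
    abel
  -- Both normalized first derivatives are co-closed, so their difference d(ξ₂ − ξ₁) is as well: ξ₂
  -- − ξ₁ is harmonic.
  have hξ : differential (ξ₂ - ξ₁) = 0 := by
    refine differential_eq_zero_of_harmonic (hξ₂.sub hξ₁) ?_
    rw [hstar, extDer_add (hα.gaugedFirst hξ₁).hodgeStar
      (hξ₂.sub hξ₁).smoothForm_differential.hodgeStar, hs₁, zero_add] at hs₂
    exact hs₂
  obtain ⟨θ, hθ, h⟩ := exists_trace_wedge_eq_add_extDer hα hβ
    (fun p u v => (hA.extDer_derivatives hε p u v).1)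
    (fun p u v => (hA.extDer_derivatives hε p u v).2) hξ₁ hξ₂ hη₁ hη₂ hξ
  rw [hK₁, hK₂]
  have hsum := surfaceIntegral_add
    (contForm_trace_wedge (hα.gaugedFirst hξ₁) (hα.gaugedSecond hβ hξ₁ hη₁)) hθ.contForm_extDer
  rw [surfaceIntegral_extDer hθ, add_zero] at hsum
  rw [← hsum]
  congr 2
  funext p u v
  exact (h p u v).symm

theorem curvatureK_eq_of_gauge_equivalent (hε : 0 < ε) (hA : IsFlatFamily G ε A)
    {B : ℝ → OneForm S Mat} {h g k : ℝ → S → Mat} (hh : IsGaugeFamily G ε h)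
    (hB : ∀ τ ∈ Ioo (-ε) ε, B τ = gaugeAct (A τ) (h τ)) (hg : IsHarmonicGauge G ε A g)
    (hk : IsHarmonicGauge G ε B k) : curvatureK B k = curvatureK A g := by
  have := isManifold_real S
  have h0 : (0 : ℝ) ∈ Ioo (-ε) ε := ⟨by linarith, hε⟩
  -- The two gauged families agree only for τ in (−ε, ε); agreement near 0 is enough for both
  -- derivatives.
  have heq : ∀ p, (fun t => gauged B k t p) =ᶠ[𝓝 0] fun t => gauged A (h * k) t p := fun p => by
    filter_upwards [isOpen_Ioo.mem_nhds h0] with t ht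
    rw [gauged_eq_gauged_mul hh hk.gauge hB ht]
  have h1 : firstDeriv (gauged B k) = firstDeriv (gauged A (h * k)) :=
    funext fun p => (heq p).deriv_eq
  have h2 : secondDeriv (gauged B k) = secondDeriv (gauged A (h * k)) :=
    funext fun p => (heq p).iteratedDeriv_eq 2
  have hhk : IsHarmonicGauge G ε A (h * k) :=
    ⟨hh.mul hk.gauge, by
      have hh1 := hk.harmonic
      rwa [h1, gauged_eq_gauged_mul hh hk.gauge hB h0] at hh1⟩
  rw [← curvatureK_eq_of_harmonicGauge hε hA hhk hg, curvatureK, curvatureK, h1, h2]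

end Main

end FlatFamily

end

theorem theorem3p2 {S : Type*} [TopologicalSpace S] [T2Space S] [CompactSpace S]
    [ConnectedSpace S] [ChartedSpace ℂ S] [IsManifold 𝓘(ℂ, ℂ) ω S]
    (G : FlatFamily.StructureGroup) (ε : ℝ) (hε : 0 < ε)
    (A : ℝ → FlatFamily.OneForm S FlatFamily.Mat) (hA : FlatFamily.IsFlatFamily G ε A) :
    (∀ g₁ g₂ : ℝ → S → FlatFamily.Mat,
      FlatFamily.IsHarmonicGauge G ε A g₁ → FlatFamily.IsHarmonicGauge G ε A g₂ →
        FlatFamily.curvatureK A g₁ = FlatFamily.curvatureK A g₂) ∧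
    (∀ (B : ℝ → FlatFamily.OneForm S FlatFamily.Mat) (h : ℝ → S → FlatFamily.Mat),
      FlatFamily.IsFlatFamily G ε B → FlatFamily.IsGaugeFamily G ε h →
      (∀ τ ∈ Set.Ioo (-ε) ε, B τ = FlatFamily.gaugeAct (A τ) (h τ)) →
      ∀ g k : ℝ → S → FlatFamily.Mat,
        FlatFamily.IsHarmonicGauge G ε A g → FlatFamily.IsHarmonicGauge G ε B k →
          FlatFamily.curvatureK B k = FlatFamily.curvatureK A g) := by
  exact ⟨fun _ _ h₁ h₂ => FlatFamily.curvatureK_eq_of_harmonicGauge hε hA h₁ h₂,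
    fun _ _ _ hh hB _ _ hg hk => FlatFamily.curvatureK_eq_of_gauge_equivalent hε hA hh hB hg hk⟩
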